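/- Let $n\ge 0$ be an integer and let $\mathbb{R}^{2n}$ carry the coordinates $(q_1,\dots,q_n,p_1,\dots,p_n)$, the symplectic form $\sum_i dp_i\wedge dq_i$ and the Poisson bracket $\{F,G\}=\sum_{i}\left(\frac{\partial F}{\partial q_i}\frac{\partial G}{\partial p_i}-\frac{\partial F}{\partial p_i}\frac{\partial G}{\partial q_i}\right)$. Homogeneity is understood with respect to positive dilations. Let $I\subseteq\mathbb{R}$ be an interval, not reduced to a point, that contains $0$, and let $\{H_t\}_{t\in I}$ be a smooth family of Hamiltonians $H_t:\mathbb{R}^{2n}\to\mathbb{R}$ that are smooth off the origin and homogeneous of degree $2$ (that is, $(t,z)\mapsto H_t(z)$ is smooth on $I\times(\mathbb{R}^{2n}\setminus 0)$, and $H_t(cz)=c^2H_t(z)$ for all $c>0$). Suppose that $H_0$ is periodic: there is $T>0$ such that all orbits of the Hamiltonian system $\dot q=\partial H_0/\partial p$, $\dot p=-\partial H_0/\partial q$ in $\mathbb{R}^{2n}\setminus 0$ are periodic of period $T$ (not necessarily the minimal period). Then for every integer $N\ge 0$ there are an isotopy $\phi^{(N)}_t:\mathbb{R}^{2n}\setminus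 0\to\mathbb{R}^{2n}\setminus 0$, $t\in I$, of the identity by smooth symplectic maps homogeneous of degree $1$ (that is, diffeomorphisms which, together with their inverses, depend smoothly on $(t,z)\in I\times(\mathbb{R}^{2n}\setminus 0)$, with $\phi^{(N)}_0=\mathrm{id}$, and each of which preserves the symplectic form and satisfies $\phi^{(N)}_t(cz)=c\,\phi^{(N)}_t(z)$ for all $c>0$), and functions $E_1,\dots,E_N:\mathbb{R}^{2n}\to\mathbb{R}$, smooth off the origin and homogeneous of degree $2$, with $\{E_i,H_0\}=0$ on $\mathbb{R}^{2n}\setminus 0$ for $1\le i\le N$, such that $$H_t\circ\phi^{(N)}_t=H_0+tE_1+\dots+t^NE_N+o(t^N)\qquad(t\to 0,\ t\in I)$$ in the smooth topology on $\mathbb{R}^{2n}\setminus 0$: for every order $m\ge 0$, the $m$-th derivative in $z$ of the remainder is $o(t^N)$ uniformly on every compact subset of $\mathbb{R}^{2n}\setminus 0$. -/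

import Mathlib

open Set Filter Topology
open scoped ContDiff

/-- The phase space `ℝ²ⁿ` with coordinates `(q, p)`: `z.1 i` is `q_i` and `z.2 i` is `p_i`. -/
abbrev PhaseSpace (n : ℕ) : Type := (Fin n → ℝ) × (Fin n → ℝ)

/-- `∂F/∂q_i` at `z`. -/
noncomputable def partialQ {n : ℕ} (F : PhaseSpace n → ℝ) (i : Fin n) (z : PhaseSpace n) : ℝ :=
  fderiv ℝ F z (Pi.single i 1, 0)

/-- `∂F/∂p_i` at `z`. -/
noncomputable def partialP {n : ℕ} (F : PhaseSpace n → ℝ) (i : Fin n) (z : PhaseSpace n) : ℝ :=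
  fderiv ℝ F z (0, Pi.single i 1)

/-- The Hamiltonian vector field `X_H = (∂H/∂p, -∂H/∂q)`. -/
noncomputable def hamiltonianField {n : ℕ} (H : PhaseSpace n → ℝ) (z : PhaseSpace n) :
    PhaseSpace n :=
  (fun i => partialP H i z, fun i => -partialQ H i z)

/-- The Poisson bracket `{F, G} = ∑ᵢ (∂F/∂q_i ∂G/∂p_i - ∂F/∂p_i ∂G/∂q_i)`. -/
noncomputable def poissonBracket {n : ℕ} (F G : PhaseSpace n → ℝ) (z : PhaseSpace n) : ℝ :=
  ∑ i, (partialQ F i z * partialP G i z - partialP F i z * partialQ G i z)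

/-- The standard symplectic form `∑ᵢ dp_i ∧ dq_i` on `ℝ²ⁿ`, the exterior derivative of
`½ ∑ᵢ (p_i dq_i - q_i dp_i)`. -/
def symplecticForm {n : ℕ} (v w : PhaseSpace n) : ℝ :=
  ∑ i, (v.2 i * w.1 i - v.1 i * w.2 i)

/-- `F` is (positively) homogeneous of degree `2`. -/
def IsHomogeneousTwo {n : ℕ} (F : PhaseSpace n → ℝ) : Prop :=
  ∀ c : ℝ, 0 < c → ∀ z : PhaseSpace n, F (c • z) = c ^ 2 * F z

/-- `H` is periodic: there is `T > 0` such that through every point of `ℝ²ⁿ \ 0` passes a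
solution, defined for all times and contained in `ℝ²ⁿ \ 0`, of Hamilton's equations
`q' = ∂H/∂p`, `p' = -∂H/∂q` that is periodic of period `T`. The common period `T` need not be
the minimal period of each orbit. -/
def IsPeriodicHamiltonian {n : ℕ} (H : PhaseSpace n → ℝ) : Prop :=
  ∃ T : ℝ, 0 < T ∧ ∀ z : PhaseSpace n, z ≠ 0 →
    ∃ γ : ℝ → PhaseSpace n, γ 0 = z ∧ (∀ s, γ s ≠ 0) ∧
      (∀ s, HasDerivAt γ (hamiltonianField H (γ s)) s) ∧ Function.Periodic γ T

/-- `φ` is, for the parameter `t ∈ I`, an isotopy of the identity of `ℝ²ⁿ \ 0` (a smooth path of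
diffeomorphisms starting at the identity) that consists of symplectic maps homogeneous of
degree `1`. The values at the origin play no role. -/
structure IsHomogeneousSymplecticIsotopy {n : ℕ} (I : Set ℝ)
    (φ : ℝ → PhaseSpace n → PhaseSpace n) : Prop where
  /-- Joint smoothness in `(t, z)`. -/
  smooth : ContDiffOn ℝ ∞ (fun x : ℝ × PhaseSpace n => φ x.1 x.2) (I ×ˢ {0}ᶜ)
  mapsTo : ∀ t ∈ I, MapsTo (φ t) {0}ᶜ {0}ᶜ
  /-- Each `φ t` is a diffeomorphism of `ℝ²ⁿ \ 0`, and the inverses depend smoothly on `t`. -/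
  inverse : ∃ ψ : ℝ → PhaseSpace n → PhaseSpace n,
    ContDiffOn ℝ ∞ (fun x : ℝ × PhaseSpace n => ψ x.1 x.2) (I ×ˢ {0}ᶜ) ∧
    ∀ t ∈ I, MapsTo (ψ t) {0}ᶜ {0}ᶜ ∧ InvOn (ψ t) (φ t) {0}ᶜ {0}ᶜ
  zero_eq_id : ∀ z : PhaseSpace n, z ≠ 0 → φ 0 z = z
  homogeneous : ∀ t ∈ I, ∀ c : ℝ, 0 < c → ∀ z : PhaseSpace n, z ≠ 0 → φ t (c • z) = c • φ t z
  symplectic : ∀ t ∈ I, ∀ z : PhaseSpace n, z ≠ 0 → ∀ v w : PhaseSpace n,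
    symplecticForm (fderiv ℝ (φ t) z v) (fderiv ℝ (φ t) z w) = symplecticForm v w

/-- `R t = o(t ^ N)` as `t → 0` in `I`, in the smooth topology of functions on `ℝ²ⁿ \ 0`: all
derivatives in the space variable, of every order, are `o(t ^ N)` uniformly on compact subsets
of `ℝ²ⁿ \ 0`. -/
def IsLittleOPowSmooth {n : ℕ} (I : Set ℝ) (N : ℕ) (R : ℝ → PhaseSpace n → ℝ) : Prop :=
  ∀ m : ℕ, ∀ K : Set (PhaseSpace n), IsCompact K → K ⊆ {0}ᶜ → ∀ ε : ℝ, 0 < ε →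
    ∀ᶠ t in 𝓝[I] (0 : ℝ), ∀ z ∈ K, ‖iteratedFDeriv ℝ m (R t) z‖ ≤ ε * |t| ^ N

/-!
The proof is Birkhoff normalisation by averaging, one power of `t` at a time
(`exists_normalForm`). The remainder is kept in the form `t ^ (N + 1) R(t, z)` with `R` smooth on
`I ×ˢ {0}ᶜ`, which Hadamard's lemma (`exists_eq_add_mul_of_contDiffOn`) provides at every stage; such
a remainder is `o(t ^ N)` in the smooth topology (`isLittleOPowSmooth_of_contDiffOn`).

For the inductive step put `F = R(0, ·)`, which is homogeneous of degree `2`. If `Φ` is the flow of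
`H 0`, of period `T`, then `E = T⁻¹ ∫₀ᵀ F ∘ Φₛ ds` is invariant under the flow and
`G = T⁻¹ ∫₀ᵀ s F ∘ Φₛ ds` satisfies `{H 0, G} + F = E` (`exists_average`). Composing the isotopy with
a symplectic isotopy `χ` that starts in the direction of the Hamiltonian field of `G`, taken at time
`t ^ (N + 1)`, replaces the coefficient `F` by `E`.

Two constructions carry the analysis.

* `E` and `G` are smooth because the flow of `H 0` is. Locally, solutions depend smoothly on the
  initial point by the implicit function theorem in `C([0, 1], E)`, where composition with a smooth
  map is a smooth operator (`exists_contDiffAt_solution`); the group law extends this to all times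
  (`IsFlowOffZero.contDiffOn`). Uniqueness is global because a field homogeneous of degree `1` is
  globally Lipschitz (`IsHomogeneousField.exists_lipschitzWith`).
* `χ` is given by the midpoint rule instead of a flow (`exists_isotopy_hasDerivAt`). For a bounded
  parameter the implicit equation is solved by contraction, again thanks to the Lipschitz bound, and
  the resulting map is symplectic because its derivative is a Cayley transform.
-/

/-! ### Integrals depending smoothly on a parameter -/

/-- Every point of `S` has arbitrarily small convex relative neighbourhoods: enough to apply the
mean value inequality near the points of a set that need not be open, such as `I ×ˢ {0}ᶜ`. -/
def HasConvexNeighborhoods {E : Type} [NormedAddCommGroup E] [NormedSpace ℝ E] (S : Set E) : Prop :=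
  ∀ x ∈ S, ∃ r : ℝ, 0 < r ∧ ∀ ρ : ℝ, ρ ≤ r → Convex ℝ (S ∩ Metric.ball x ρ)

section ParametricIntegral

variable {E F : Type} [NormedAddCommGroup E] [NormedSpace ℝ E] [NormedAddCommGroup F]
  [NormedSpace ℝ F]

theorem IsOpen.hasConvexNeighborhoods {S : Set E} (hS : IsOpen S) : HasConvexNeighborhoods S := by
  intro x hx
  obtain ⟨r, hr, h⟩ := Metric.isOpen_iff.1 hS x hx
  refine ⟨r, hr, fun ρ hρ => ?_⟩
  rw [inter_eq_self_of_subset_right ((Metric.ball_subset_ball hρ).trans h)]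
  exact convex_ball x ρ

theorem HasConvexNeighborhoods.convex_prod {I : Set ℝ} (hI : Convex ℝ I) {S : Set E}
    (hS : IsOpen S) : HasConvexNeighborhoods (I ×ˢ S) := by
  rintro ⟨t, x⟩ ⟨ht, hx⟩
  obtain ⟨r, hr, h⟩ := hS.hasConvexNeighborhoods x hx
  refine ⟨r, hr, fun ρ hρ => ?_⟩
  rw [← ball_prod_same, prod_inter_prod]
  exact (hI.inter (convex_ball _ _)).prod (h ρ hρ)

theorem uniqueDiffOn_interval {I : Set ℝ} (hI : I.OrdConnected) (hI' : I.Nontrivial) :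
    UniqueDiffOn ℝ I := by
  refine uniqueDiffOn_convex hI.convex ?_
  obtain ⟨a, ha, b, hb, hab⟩ := hI'.exists_lt
  exact ⟨(a + b) / 2, interior_mono (hI.out ha hb)
    (by rw [interior_Icc]; constructor <;> linarith)⟩

/-- Differentiation under the integral sign over a compact interval, on a parameter set that need
not be open. -/
theorem hasFDerivWithinAt_intervalIntegral {S : Set E} (hS : HasConvexNeighborhoods S) {a b : ℝ}
    (hab : a < b) {f : E → ℝ → F} {f' : E → ℝ → E →L[ℝ] F}
    (hf : ContinuousOn (Function.uncurry f) (S ×ˢ Icc a b))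
    (hf' : ContinuousOn (Function.uncurry f') (S ×ˢ Icc a b))
    (hd : ∀ x ∈ S, ∀ s ∈ Icc a b, HasFDerivWithinAt (fun y => f y s) (f' x s) S x)
    {x : E} (hx : x ∈ S) :
    HasFDerivWithinAt (fun y => ∫ s in a..b, f y s) (∫ s in a..b, f' x s) S x := by
  have hint : ∀ y ∈ S, IntervalIntegrable (f y) MeasureTheory.volume a b := fun y hy => by
    apply ContinuousOn.intervalIntegrable
    rw [uIcc_of_le hab.le]
    exact hf.comp (f := fun s => (y, s)) (by fun_prop) (fun s hs => ⟨hy, hs⟩)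
  have hint' : IntervalIntegrable (f' x) MeasureTheory.volume a b := by
    apply ContinuousOn.intervalIntegrable
    rw [uIcc_of_le hab.le]
    exact hf'.comp (f := fun s => (x, s)) (by fun_prop) (fun s hs => ⟨hx, hs⟩)
  rw [hasFDerivWithinAt_iff_isLittleO, Asymptotics.isLittleO_iff]
  intro c hc
  have hba : 0 < b - a := sub_pos.2 hab
  obtain ⟨v, hv, hvx⟩ := isCompact_Icc.mem_uniformity_of_prod hf' hx
    (Metric.dist_mem_uniformity (div_pos hc hba))
  obtain ⟨δ, hδ, hδv⟩ := Metric.mem_nhdsWithin_iff.1 hv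
  obtain ⟨r, hr, hconv⟩ := hS x hx
  have hρ : 0 < min δ r := lt_min hδ hr
  filter_upwards [inter_mem_nhdsWithin S (Metric.ball_mem_nhds x hρ)] with y hy
  have hmem : x ∈ S ∩ Metric.ball x (min δ r) := ⟨hx, Metric.mem_ball_self hρ⟩
  have key : ∀ s ∈ Icc a b, ‖f y s - f x s - f' x s (y - x)‖ ≤ c / (b - a) * ‖y - x‖ := by
    intro s hs
    refine (hconv _ (min_le_right _ _)).norm_image_sub_le_of_norm_hasFDerivWithin_le'
      (f := fun y => f y s) (f' := fun y => f' y s)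
      (fun z hz => (hd z hz.1 s hs).mono inter_subset_left) (fun z hz => ?_) hmem hy
    have := hvx z (hδv ⟨Metric.ball_subset_ball (min_le_left _ _) hz.2, hz.1⟩) s hs
    rw [← dist_eq_norm]
    exact (show dist (f' z s) (f' x s) < c / (b - a) from this).le
  have happ : (∫ s in a..b, f' x s) (y - x) = ∫ s in a..b, f' x s (y - x) :=
    ContinuousLinearMap.intervalIntegral_apply hint' _
  have hia : IntervalIntegrable (fun s => f' x s (y - x)) MeasureTheory.volume a b := by
    apply ContinuousOn.intervalIntegrable
    rw [uIcc_of_le hab.le]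
    exact (hf'.comp (f := fun s => (x, s)) (by fun_prop) (fun s hs => ⟨hx, hs⟩)).clm_apply
      continuousOn_const
  rw [happ, ← intervalIntegral.integral_sub (hint y hy.1) (hint x hx),
    ← intervalIntegral.integral_sub ((hint y hy.1).sub (hint x hx)) hia]
  refine (intervalIntegral.norm_integral_le_of_norm_le_const (C := c / (b - a) * ‖y - x‖)
    fun s hs => ?_).trans (le_of_eq ?_)
  · rw [uIoc_of_le hab.le] at hs
    exact key s ⟨hs.1.le, hs.2⟩
  · rw [abs_of_pos hba]
    field_simp

theorem contDiffOn_intervalIntegral_nat {S : Set E} (hS : HasConvexNeighborhoods S)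
    (hS' : UniqueDiffOn ℝ S) {a b : ℝ} (hab : a < b) (k : ℕ) :
    ∀ {F : Type} [NormedAddCommGroup F] [NormedSpace ℝ F] {f : E → ℝ → F},
      ContDiffOn ℝ ∞ (Function.uncurry f) (S ×ˢ Icc a b) →
      ContDiffOn ℝ k (fun x => ∫ s in a..b, f x s) S := by
  have hU : UniqueDiffOn ℝ (S ×ˢ Icc a b) := hS'.prod (uniqueDiffOn_Icc hab)
  have main : ∀ {F : Type} [NormedAddCommGroup F] [NormedSpace ℝ F] {f : E → ℝ → F},
      ContDiffOn ℝ ∞ (Function.uncurry f) (S ×ˢ Icc a b) →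
      ∃ f' : E → ℝ → E →L[ℝ] F, ContDiffOn ℝ ∞ (Function.uncurry f') (S ×ˢ Icc a b) ∧
        ∀ x ∈ S, HasFDerivWithinAt (fun y => ∫ s in a..b, f y s) (∫ s in a..b, f' x s) S x := by
    intro F _ _ f hf
    have hD : ContDiffOn ℝ ∞ (fderivWithin ℝ (Function.uncurry f) (S ×ˢ Icc a b))
        (S ×ˢ Icc a b) := hf.fderivWithin hU (by simp)
    have hf' : ContDiffOn ℝ ∞ (Function.uncurry fun x s =>
        (fderivWithin ℝ (Function.uncurry f) (S ×ˢ Icc a b) (x, s)).comp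
          (ContinuousLinearMap.inl ℝ E ℝ)) (S ×ˢ Icc a b) :=
      ContDiffOn.clm_comp hD contDiffOn_const
    refine ⟨_, hf', fun x hx =>
      hasFDerivWithinAt_intervalIntegral hS hab hf.continuousOn hf'.continuousOn ?_ hx⟩
    intro x hx s hs
    have h1 := ((hf.differentiableOn (by simp)) (x, s) ⟨hx, hs⟩).hasFDerivWithinAt
    have h2 : MapsTo (fun y : E => (y, s)) S (S ×ˢ Icc a b) := fun y hy => ⟨hy, hs⟩
    exact h1.comp (f := fun y : E => (y, s)) x
      (hasFDerivAt_prodMk_left x s).hasFDerivWithinAt h2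
  induction k with
  | zero =>
    intro F _ _ f hf
    obtain ⟨f', -, hf'⟩ := main hf
    exact contDiffOn_zero.2 fun x hx => (hf' x hx).continuousWithinAt
  | succ k ih =>
    intro F _ _ f hf
    obtain ⟨f', hf', hd⟩ := main hf
    rw [Nat.cast_add, Nat.cast_one, contDiffOn_succ_iff_hasFDerivWithinAt_of_uniqueDiffOn hS']
    exact ⟨by simp, _, ih hf', hd⟩

/-- The integral over a compact interval of a smooth function is a smooth function of the
parameters. -/
theorem contDiffOn_intervalIntegral {S : Set E} (hS : HasConvexNeighborhoods S)
    (hS' : UniqueDiffOn ℝ S) {a b : ℝ} (hab : a < b) {f : E → ℝ → F}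
    (hf : ContDiffOn ℝ ∞ (Function.uncurry f) (S ×ˢ Icc a b)) :
    ContDiffOn ℝ ∞ (fun x => ∫ s in a..b, f x s) S :=
  contDiffOn_infty.2 fun k => contDiffOn_intervalIntegral_nat hS hS' hab k hf

/-- **Hadamard's lemma**: a smooth function of `(t, z)` is divisible by `t`, with smooth quotient,
after subtracting its value at `t = 0`. The quotient is `∫₀¹ ∂ₜf(st, z) ds`. -/
theorem exists_eq_add_mul_of_contDiffOn {I : Set ℝ} (hI : I.OrdConnected) (hI' : I.Nontrivial)
    (h0 : (0 : ℝ) ∈ I) {S : Set E} (hS : IsOpen S) {f : ℝ × E → ℝ}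
    (hf : ContDiffOn ℝ ∞ f (I ×ˢ S)) :
    ∃ g : ℝ × E → ℝ, ContDiffOn ℝ ∞ g (I ×ˢ S) ∧
      ∀ t ∈ I, ∀ z ∈ S, f (t, z) = f (0, z) + t * g (t, z) := by
  have hU : UniqueDiffOn ℝ (I ×ˢ S) := (uniqueDiffOn_interval hI hI').prod hS.uniqueDiffOn
  have hst : ∀ t ∈ I, ∀ s ∈ Icc (0 : ℝ) 1, s * t ∈ I := fun t ht s hs => by
    have := hI.convex.starConvex h0 ht (sub_nonneg.2 hs.2) hs.1 (by ring)
    simpa using this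
  have hD : ContDiffOn ℝ ∞ (fderivWithin ℝ f (I ×ˢ S)) (I ×ˢ S) := hf.fderivWithin hU (by simp)
  have hsm : ContDiffOn ℝ ∞ (Function.uncurry fun (x : ℝ × E) (s : ℝ) =>
      fderivWithin ℝ f (I ×ˢ S) (s * x.1, x.2) (1, 0)) ((I ×ˢ S) ×ˢ Icc 0 1) := by
    refine ContDiffOn.clm_apply ?_ contDiffOn_const
    exact hD.comp (f := fun y : (ℝ × E) × ℝ => (y.2 * y.1.1, y.1.2))
      (ContDiff.contDiffOn (by fun_prop)) (fun y hy => ⟨hst _ hy.1.1 _ hy.2, hy.1.2⟩)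
  refine ⟨_, contDiffOn_intervalIntegral (HasConvexNeighborhoods.convex_prod hI.convex hS) hU
    zero_lt_one hsm, fun t ht z hz => ?_⟩
  have hder : ∀ s ∈ Icc (0 : ℝ) 1, HasDerivWithinAt (fun s : ℝ => f (s * t, z))
      (t * fderivWithin ℝ f (I ×ˢ S) (s * t, z) (1, 0)) (Icc 0 1) s := by
    intro s hs
    have h1 := ((hf.differentiableOn (by simp)) (s * t, z) ⟨hst t ht s hs, hz⟩).hasFDerivWithinAt
    have h2 : HasDerivWithinAt (fun s : ℝ => (s * t, z)) (t, (0 : E)) (Icc 0 1) s := by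
      refine HasDerivWithinAt.prodMk ?_ (hasDerivWithinAt_const _ _ _)
      simpa using (hasDerivWithinAt_id s (Icc 0 1)).mul_const t
    have hmaps : MapsTo (fun s : ℝ => (s * t, z)) (Icc 0 1) (I ×ˢ S) :=
      fun r hr => ⟨hst t ht r hr, hz⟩
    have h3 := h1.comp_hasDerivWithinAt (f := fun s : ℝ => (s * t, z)) s h2 hmaps
    refine h3.congr_deriv ?_
    rw [show (t, (0 : E)) = t • ((1 : ℝ), (0 : E)) by simp, map_smul, smul_eq_mul]
  have hcont : ContinuousOn (fun s : ℝ => fderivWithin ℝ f (I ×ˢ S) (s * t, z) (1, 0))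
      (Icc 0 1) :=
    hsm.continuousOn.comp (f := fun s : ℝ => ((t, z), s)) (by fun_prop) (fun s hs => ⟨⟨ht, hz⟩, hs⟩)
  have hftc := intervalIntegral.integral_eq_sub_of_hasDerivAt_of_le (zero_le_one' ℝ)
    (fun s hs => (hder s hs).continuousWithinAt)
    (fun s hs => (hder s ⟨hs.1.le, hs.2.le⟩).hasDerivAt (Icc_mem_nhds hs.1 hs.2))
    (ContinuousOn.intervalIntegrable (by
      rw [uIcc_of_le zero_le_one]; exact continuousOn_const.mul hcont))
  rw [intervalIntegral.integral_const_mul] at hftc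
  simp only [one_mul, zero_mul] at hftc
  rw [hftc]
  ring

end ParametricIntegral

/-! ### Smooth dependence of solutions of differential equations on the initial point -/

section Nemytskii

variable {K E F : Type} [TopologicalSpace K] [CompactSpace K]
  [NormedAddCommGroup E] [NormedSpace ℝ E] [NormedAddCommGroup F] [NormedSpace ℝ F]

/-- The pointwise evaluation of a continuous family of linear maps on a continuous family of
vectors, as a continuous bilinear map. -/
noncomputable def pointwiseApply : C(K, E →L[ℝ] F) →L[ℝ] C(K, E) →L[ℝ] C(K, F) :=
  LinearMap.mkContinuous₂
    (LinearMap.mk₂ ℝ (fun (A : C(K, E →L[ℝ] F)) (h : C(K, E)) =>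
        (⟨fun x => A x (h x), by fun_prop⟩ : C(K, F)))
      (fun A B h => by ext x; simp) (fun c A h => by ext x; simp)
      (fun A h k => by ext x; simp) (fun c A h => by ext x; simp)) 1
    (fun A h => by
      rw [ContinuousMap.norm_le _ (by positivity), one_mul]
      intro x
      exact (A x).le_of_opNorm_le_of_le (A.norm_coe_le_norm x) (h.norm_coe_le_norm x))

@[simp]
theorem pointwiseApply_apply (A : C(K, E →L[ℝ] F)) (h : C(K, E)) (x : K) :
    pointwiseApply A h x = A x (h x) := rfl

/-- The composition operator `γ ↦ f ∘ γ` between spaces of continuous maps is differentiable, with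
derivative at `γ` the pointwise application of `Df ∘ γ`. -/
theorem hasFDerivAt_continuousMap_comp {f : C(E, F)} {f' : C(E, E →L[ℝ] F)}
    (hf : ∀ x, HasFDerivAt f (f' x) x) (γ : C(K, E)) :
    HasFDerivAt (fun η : C(K, E) => f.comp η) (pointwiseApply (f'.comp γ)) γ := by
  rw [hasFDerivAt_iff_isLittleO, Asymptotics.isLittleO_iff]
  intro c hc
  have hcont : Continuous fun η : C(K, E) => f'.comp η := f'.continuous_postcomp
  obtain ⟨δ, hδ, hδc⟩ := (Metric.continuousAt_iff
    (f := fun η : C(K, E) => f'.comp η) (a := γ)).1 hcont.continuousAt c hc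
  filter_upwards [Metric.ball_mem_nhds γ hδ] with η hη
  rw [ContinuousMap.norm_le _ (by positivity)]
  intro x
  have hηx : η x ∈ Metric.ball (γ x) δ :=
    (ContinuousMap.dist_apply_le_dist x).trans_lt hη
  have hb : ∀ y ∈ Metric.ball (γ x) δ, ‖f' y - f' (γ x)‖ ≤ c := by
    intro y hy
    -- a single value of the curve is perturbed by translating the whole curve
    have h1 : dist (γ + ContinuousMap.const K (y - γ x)) γ < δ := by
      rw [dist_eq_norm, add_sub_cancel_left, ContinuousMap.norm_lt_iff _ hδ]
      intro _
      rw [Metric.mem_ball, dist_eq_norm] at hy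
      exact hy
    have h2 := (ContinuousMap.dist_apply_le_dist x).trans_lt (hδc h1)
    rw [← dist_eq_norm]
    simpa using h2.le
  have h3 := (convex_ball (γ x) δ).norm_image_sub_le_of_norm_hasFDerivWithin_le'
    (fun y _ => (hf y).hasFDerivWithinAt) hb (Metric.mem_ball_self hδ) hηx
  refine h3.trans ?_
  gcongr
  exact (η - γ).norm_coe_le_norm x

theorem contDiff_continuousMap_comp_nat (k : ℕ) :
    ∀ {F : Type} [NormedAddCommGroup F] [NormedSpace ℝ F] {f : C(E, F)}, ContDiff ℝ ∞ f →
      ContDiff ℝ k (fun η : C(K, E) => f.comp η) := by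
  induction k with
  | zero => exact fun {F} _ _ f _ => contDiff_zero.2 f.continuous_postcomp
  | succ k ih =>
    intro F _ _ f hf
    have hf' := contDiff_infty_iff_fderiv.1 hf
    let f' : C(E, E →L[ℝ] F) := ⟨fderiv ℝ f, hf'.2.continuous⟩
    rw [Nat.cast_add, Nat.cast_one, contDiff_succ_iff_hasFDerivAt]
    exact ⟨_, pointwiseApply.contDiff.comp (ih (f := f') hf'.2),
      fun γ => hasFDerivAt_continuousMap_comp (fun x => (hf'.1 x).hasFDerivAt) γ⟩

/-- The composition operator `γ ↦ f ∘ γ` with a smooth map `f` is smooth. -/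
theorem contDiff_continuousMap_comp {f : C(E, F)} (hf : ContDiff ℝ ∞ f) :
    ContDiff ℝ ∞ (fun η : C(K, E) => f.comp η) :=
  contDiff_infty.2 fun k => contDiff_continuousMap_comp_nat k hf

/-- The constant maps, as a continuous linear embedding of `E` into `C(K, E)`. -/
noncomputable def constCurve : E →L[ℝ] C(K, E) :=
  LinearMap.mkContinuous
    { toFun := fun z => ContinuousMap.const K z
      map_add' := fun _ _ => rfl
      map_smul' := fun _ _ => rfl } 1
    (fun z => by
      rw [ContinuousMap.norm_le _ (by positivity), one_mul]
      exact fun _ => le_rfl)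

@[simp]
theorem constCurve_apply (z : E) (x : K) : constCurve (K := K) z x = z := rfl

/-- The primitive vanishing at `0`, as an operator on continuous curves `[0, 1] → E`. -/
noncomputable def primitiveCurve : C(Icc (0 : ℝ) 1, E) →L[ℝ] C(Icc (0 : ℝ) 1, E) :=
  have hi (γ : C(Icc (0 : ℝ) 1, E)) (a b : ℝ) :
      IntervalIntegrable (IccExtend zero_le_one γ) MeasureTheory.volume a b :=
    (γ.continuous.Icc_extend' (h := zero_le_one)).intervalIntegrable a b
  LinearMap.mkContinuous
    { toFun := fun γ => ⟨fun s => ∫ r in (0 : ℝ)..s, IccExtend zero_le_one γ r,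
        (intervalIntegral.continuous_primitive (hi γ) 0).comp continuous_subtype_val⟩
      map_add' := fun γ η => by
        ext s
        exact intervalIntegral.integral_add (hi γ _ _) (hi η _ _)
      map_smul' := fun c γ => by
        ext s
        exact intervalIntegral.integral_smul c _ } 1
    (fun γ => by
      rw [ContinuousMap.norm_le _ (by positivity), one_mul]
      intro s
      refine (intervalIntegral.norm_integral_le_of_norm_le_const (C := ‖γ‖)
        fun r _ => γ.norm_coe_le_norm _).trans ?_
      rw [sub_zero, abs_of_nonneg s.2.1]
      exact mul_le_of_le_one_right (norm_nonneg _) s.2.2)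

theorem primitiveCurve_apply (γ : C(Icc (0 : ℝ) 1, E)) (s : Icc (0 : ℝ) 1) :
    primitiveCurve γ s = ∫ r in (0 : ℝ)..s, IccExtend zero_le_one γ r := rfl

/-- Local solutions of `γ' = δ X(γ)`, `γ(0) = z` on the unit time interval depend smoothly on
`(δ, z)` near `δ = 0`. The integral equation has derivative the identity in `γ` at `δ = 0`, so the
implicit function theorem applies to it without any smallness condition. -/
theorem exists_contDiffAt_solution [CompleteSpace E] {X : E → E} (hX : ContDiff ℝ ∞ X) (z₀ : E) :
    ∃ g : ℝ × E → C(Icc (0 : ℝ) 1, E), ContDiffAt ℝ ∞ g (0, z₀) ∧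
      g (0, z₀) = ContinuousMap.const _ z₀ ∧
      ∀ᶠ p in 𝓝 ((0 : ℝ), z₀), ∀ s : Icc (0 : ℝ) 1,
        g p s = p.2 + p.1 • ∫ r in (0 : ℝ)..s, X (IccExtend zero_le_one (g p) r) := by
  let N : C(Icc (0 : ℝ) 1, E) → C(Icc (0 : ℝ) 1, E) :=
    fun γ => (⟨X, hX.continuous⟩ : C(E, E)).comp γ
  have hN : ContDiff ℝ ∞ N := contDiff_continuousMap_comp hX
  let P : (ℝ × E) × C(Icc (0 : ℝ) 1, E) → C(Icc (0 : ℝ) 1, E) :=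
    fun q => q.2 - constCurve q.1.2 - q.1.1 • primitiveCurve (N q.2)
  have hP : ContDiff ℝ ∞ P := by
    refine (contDiff_snd.sub ((constCurve (K := Icc (0 : ℝ) 1) (E := E)).contDiff.comp
      contDiff_fst.snd)).sub
      (contDiff_fst.fst.smul (primitiveCurve.contDiff.comp (hN.comp contDiff_snd)))
  let u : (ℝ × E) × C(Icc (0 : ℝ) 1, E) := ((0, z₀), constCurve z₀)
  have hPu : P u = 0 := by simp [P, u]
  have hpart : fderiv ℝ P u ∘L .inr ℝ (ℝ × E) C(Icc (0 : ℝ) 1, E) = .id ℝ _ := by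
    have h1 : HasFDerivAt (fun γ : C(Icc (0 : ℝ) 1, E) => P (u.1, γ))
        (fderiv ℝ P u ∘L .inr ℝ (ℝ × E) C(Icc (0 : ℝ) 1, E)) u.2 :=
      ((hP.differentiable (by simp)) u).hasFDerivAt.comp
        (f := fun γ : C(Icc (0 : ℝ) 1, E) => (u.1, γ)) u.2 (hasFDerivAt_prodMk_right u.1 u.2)
    refine h1.unique ?_
    have h2 : (fun γ : C(Icc (0 : ℝ) 1, E) => P (u.1, γ)) = fun γ => γ - constCurve z₀ := by
      funext γ
      simp [P, u]
    rw [h2]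
    exact (hasFDerivAt_id _).sub_const _
  have hinv : (fderiv ℝ P u ∘L .inr ℝ (ℝ × E) C(Icc (0 : ℝ) 1, E)).IsInvertible := by
    rw [hpart]
    exact ContinuousLinearMap.isInvertible_equiv (f := .refl ℝ _)
  have hPat : ContDiffAt ℝ ∞ P u := hP.contDiffAt
  refine ⟨hPat.implicitFunction (by simp) hinv, hPat.contDiffAt_implicitFunction _ _,
    hPat.implicitFunction_apply_self _ _, ?_⟩
  filter_upwards [hPat.eventually_apply_implicitFunction (by simp) hinv] with p hp s
  rw [hPu] at hp
  have h3 := congrArg (fun η : C(Icc (0 : ℝ) 1, E) => η s) hp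
  simp only [P, ContinuousMap.sub_apply, ContinuousMap.smul_apply, constCurve_apply,
    primitiveCurve_apply, ContinuousMap.zero_apply] at h3
  rw [sub_sub, sub_eq_zero] at h3
  rw [h3]
  rfl

end Nemytskii

/-- A map that is smooth near a point agrees near that point with a globally smooth map. -/
theorem exists_contDiff_eventuallyEq {E F : Type} [NormedAddCommGroup E] [NormedSpace ℝ E]
    [FiniteDimensional ℝ E] [NormedAddCommGroup F] [NormedSpace ℝ F] {U : Set E} (hU : IsOpen U)
    {f : E → F} (hf : ContDiffOn ℝ ∞ f U) {z : E} (hz : z ∈ U) :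
    ∃ g : E → F, ContDiff ℝ ∞ g ∧ g =ᶠ[𝓝 z] f := by
  obtain ⟨r, hr, hrU⟩ := Metric.isOpen_iff.1 hU z hz
  let b : ContDiffBump z := ⟨r / 4, r / 2, by positivity, by linarith⟩
  refine ⟨fun x => b x • f x, ?_, ?_⟩
  · refine contDiff_iff_contDiffAt.2 fun x => ?_
    by_cases hx : x ∈ U
    · exact b.contDiff.contDiffAt.smul (hf.contDiffAt (hU.mem_nhds hx))
    · have h1 : (fun x => b x • f x) =ᶠ[𝓝 x] fun _ => 0 := by
        filter_upwards [Metric.isClosed_closedBall.isOpen_compl.mem_nhds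
          (show x ∉ Metric.closedBall z (r / 2) from
            fun h => hx (hrU (Metric.closedBall_subset_ball (by linarith) h)))] with y hy
        rw [b.zero_of_le_dist (not_le.1 fun h => hy (Metric.mem_closedBall.2 h)).le, zero_smul]
      exact contDiffAt_const.congr_of_eventuallyEq h1
  · filter_upwards [b.eventuallyEq_one] with x hx
    simp [hx]

/-! ### Vector fields homogeneous of degree one and their flows -/

/-- A vector field that is smooth off the origin and homogeneous of degree `1`; it is required to
vanish at the origin, so that it is continuous there. -/
structure IsHomogeneousField {E : Type} [NormedAddCommGroup E] [NormedSpace ℝ E]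
    (Y : E → E) : Prop where
  map_zero : Y 0 = 0
  map_smul : ∀ c : ℝ, 0 < c → ∀ z, Y (c • z) = c • Y z
  contDiffOn : ContDiffOn ℝ ∞ Y {0}ᶜ

namespace IsHomogeneousField

variable {E : Type} [NormedAddCommGroup E] [NormedSpace ℝ E] {Y : E → E}

theorem contDiffAt (hY : IsHomogeneousField Y) {z : E} (hz : z ≠ 0) : ContDiffAt ℝ ∞ Y z :=
  hY.contDiffOn.contDiffAt (isOpen_compl_singleton.mem_nhds hz)

theorem fderiv_smul (hY : IsHomogeneousField Y) {c : ℝ} (hc : 0 < c) {z : E} (hz : z ≠ 0) :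
    fderiv ℝ Y (c • z) = fderiv ℝ Y z := by
  have h1 : (fun z => Y (c • z)) = fun z => c • Y z := funext (hY.map_smul c hc)
  have h2 := congrArg (fun f => fderiv ℝ f z) h1
  simp only [fderiv_comp_smul,
    fderiv_fun_const_smul ((hY.contDiffAt hz).differentiableAt (by simp))] at h2
  exact smul_right_injective _ hc.ne' h2

/-- The derivative of a field homogeneous of degree `1` is homogeneous of degree `0`, hence
bounded by its values on the unit sphere, so the field is globally Lipschitz. -/
theorem exists_lipschitzWith [FiniteDimensional ℝ E] (hY : IsHomogeneousField Y) :
    ∃ L : NNReal, LipschitzWith L Y := by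
  have hsub : Metric.sphere (0 : E) 1 ⊆ {0}ᶜ := fun x hx h => by
    rw [mem_singleton_iff.1 h] at hx
    simp at hx
  have hcpt : IsCompact (Metric.sphere (0 : E) 1) := isCompact_sphere 0 1
  obtain ⟨M₁, hM₁⟩ := hcpt.exists_bound_of_continuousOn
    ((hY.contDiffOn.continuousOn_fderiv_of_isOpen isOpen_compl_singleton (by simp)).mono hsub)
  obtain ⟨M₂, hM₂⟩ := hcpt.exists_bound_of_continuousOn (hY.contDiffOn.continuousOn.mono hsub)
  let L : NNReal := ⟨max 0 (max M₁ M₂), le_max_left _ _⟩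
  have hLM₁ : M₁ ≤ L := (le_max_left _ _).trans (le_max_right _ _)
  have hLM₂ : M₂ ≤ L := (le_max_right _ _).trans (le_max_right _ _)
  have hunit : ∀ z : E, z ≠ 0 → ‖z‖⁻¹ • z ∈ Metric.sphere (0 : E) 1 := fun z hz => by
    rw [mem_sphere_zero_iff_norm, norm_smul, norm_inv, norm_norm,
      inv_mul_cancel₀ (norm_ne_zero_iff.2 hz)]
  have hsmul : ∀ z : E, z ≠ 0 → z = ‖z‖ • ‖z‖⁻¹ • z := fun z hz => by
    rw [smul_smul, mul_inv_cancel₀ (norm_ne_zero_iff.2 hz), one_smul]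
  have hD : ∀ z : E, z ≠ 0 → ‖fderiv ℝ Y z‖ ≤ L := fun z hz => by
    rw [hsmul z hz, hY.fderiv_smul (norm_pos_iff.2 hz) (hsub (hunit z hz))]
    exact (hM₁ _ (hunit z hz)).trans hLM₁
  have hN : ∀ z : E, ‖Y z‖ ≤ L * ‖z‖ := fun z => by
    rcases eq_or_ne z 0 with rfl | hz
    · simp [hY.map_zero]
    · have h1 : ‖Y z‖ = ‖z‖ * ‖Y (‖z‖⁻¹ • z)‖ := by
        conv_lhs => rw [hsmul z hz, hY.map_smul _ (norm_pos_iff.2 hz), norm_smul, norm_norm]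
      rw [h1, mul_comm]
      exact mul_le_mul_of_nonneg_right ((hM₂ _ (hunit z hz)).trans hLM₂) (norm_nonneg _)
  refine ⟨L, LipschitzWith.of_dist_le_mul fun x y => ?_⟩
  -- the mean value inequality is not available on a segment through the origin, where `Y` need not
  -- be differentiable, but there `‖x‖ + ‖y‖ = ‖x - y‖`
  by_cases h0 : (0 : E) ∈ segment ℝ x y
  · rw [dist_eq_norm, ← dist_add_dist_of_mem_segment h0, dist_zero_right, dist_zero_left, mul_add]
    exact (norm_sub_le _ _).trans (add_le_add (hN x) (hN y))
  · rw [dist_comm, dist_comm x y, dist_eq_norm, dist_eq_norm]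
    have hne : ∀ z ∈ segment ℝ x y, z ≠ 0 := fun z hz h => h0 (h ▸ hz)
    exact (convex_segment x y).norm_image_sub_le_of_norm_fderiv_le
      (fun z hz => (hY.contDiffAt (hne z hz)).differentiableAt (by simp))
      (fun z hz => hD z (hne z hz)) (left_mem_segment ℝ x y) (right_mem_segment ℝ x y)

theorem eq_of_hasDerivAt [FiniteDimensional ℝ E] (hY : IsHomogeneousField Y) {γ η : ℝ → E}
    (hγ : ∀ s, HasDerivAt γ (Y (γ s)) s) (hη : ∀ s, HasDerivAt η (Y (η s)) s)
    (h0 : γ 0 = η 0) : γ = η := by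
  obtain ⟨L, hL⟩ := hY.exists_lipschitzWith
  exact ODE_solution_unique_univ (v := fun _ => Y) (s := fun _ => univ) (K := L)
    (fun _ => hL.lipschitzOnWith) (fun s => ⟨hγ s, mem_univ _⟩) (fun s => ⟨hη s, mem_univ _⟩) h0

end IsHomogeneousField

/-- `Φ` is the flow of `Y` on the complement of the origin, complete there. -/
structure IsFlowOffZero {E : Type} [NormedAddCommGroup E] [NormedSpace ℝ E]
    (Y : E → E) (Φ : ℝ → E → E) : Prop where
  map_zero : ∀ z, z ≠ 0 → Φ 0 z = z
  ne_zero : ∀ s z, z ≠ 0 → Φ s z ≠ 0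
  hasDerivAt : ∀ s z, z ≠ 0 → HasDerivAt (fun r => Φ r z) (Y (Φ s z)) s

namespace IsFlowOffZero

variable {E : Type} [NormedAddCommGroup E] [NormedSpace ℝ E] [FiniteDimensional ℝ E]
  {Y : E → E} {Φ : ℝ → E → E}

theorem map_add (hΦ : IsFlowOffZero Y Φ) (hY : IsHomogeneousField Y) (s r : ℝ) {z : E}
    (hz : z ≠ 0) : Φ (s + r) z = Φ s (Φ r z) := by
  have h := hY.eq_of_hasDerivAt (γ := fun s => Φ (s + r) z) (η := fun s => Φ s (Φ r z))
    (fun s => (hΦ.hasDerivAt (s + r) z hz).comp_add_const s r)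
    (fun s => hΦ.hasDerivAt s _ (hΦ.ne_zero r z hz))
    (by rw [zero_add, hΦ.map_zero _ (hΦ.ne_zero r z hz)])
  exact congrFun h s

theorem map_smul (hΦ : IsFlowOffZero Y Φ) (hY : IsHomogeneousField Y) (s : ℝ) {c : ℝ}
    (hc : 0 < c) {z : E} (hz : z ≠ 0) : Φ s (c • z) = c • Φ s z := by
  have hcz : c • z ≠ 0 := smul_ne_zero hc.ne' hz
  have h := hY.eq_of_hasDerivAt (γ := fun s => Φ s (c • z)) (η := fun s => c • Φ s z)
    (fun s => hΦ.hasDerivAt s _ hcz)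
    (fun s => by
      rw [hY.map_smul c hc]
      exact (hΦ.hasDerivAt s z hz).const_smul c)
    (by rw [hΦ.map_zero _ hcz, hΦ.map_zero _ hz])
  exact congrFun h s

/-- Near time zero the flow coincides with the smooth family of solutions obtained from the
implicit function theorem. -/
theorem contDiffAt_zero (hΦ : IsFlowOffZero Y Φ) (hY : IsHomogeneousField Y) {z₀ : E}
    (hz₀ : z₀ ≠ 0) : ContDiffAt ℝ ∞ (fun p : ℝ × E => Φ p.1 p.2) (0, z₀) := by
  obtain ⟨L, hL⟩ := hY.exists_lipschitzWith
  obtain ⟨X, hX, hXY⟩ := exists_contDiff_eventuallyEq isOpen_compl_singleton hY.contDiffOn hz₀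
  obtain ⟨g, hg, hg0, hgeq⟩ := exists_contDiffAt_solution hX z₀
  obtain ⟨ρ, hρ, hball⟩ := Metric.eventually_nhds_iff.1 hXY
  have hclose : ∀ᶠ p in 𝓝 ((0 : ℝ), z₀), dist (g p) (ContinuousMap.const _ z₀) < ρ := by
    have := hg.continuousAt
    rw [ContinuousAt, hg0] at this
    exact this.eventually (Metric.ball_mem_nhds _ hρ)
  have hne : ∀ᶠ p in 𝓝 ((0 : ℝ), z₀), p.2 ≠ 0 :=
    continuousAt_snd.eventually_ne hz₀
  let ev : C(Icc (0 : ℝ) 1, E) →L[ℝ] E := ContinuousMap.evalCLM ℝ 1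
  have hev : (fun p : ℝ × E => Φ p.1 p.2) =ᶠ[𝓝 (0, z₀)] fun p => ev (g p) := by
    filter_upwards [hgeq, hclose, hne] with p hp hpc hp0
    let h : ℝ → E := fun s => p.2 + p.1 • ∫ r in (0 : ℝ)..s, X (IccExtend zero_le_one (g p) r)
    have hcont : Continuous fun r => X (IccExtend zero_le_one (g p) r) :=
      hX.continuous.comp ((g p).continuous.Icc_extend' (h := zero_le_one))
    have hh : ∀ s, HasDerivAt h (p.1 • X (IccExtend zero_le_one (g p) s)) s := fun s =>
      ((intervalIntegral.integral_hasDerivAt_right (hcont.intervalIntegrable _ _)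
        (hcont.stronglyMeasurableAtFilter _ _) hcont.continuousAt).const_smul p.1).const_add p.2
    have hgh : ∀ s ∈ Icc (0 : ℝ) 1, IccExtend zero_le_one (g p) s = h s := fun s hs => by
      rw [IccExtend_of_mem _ _ hs]
      exact hp ⟨s, hs⟩
    have hXYs : ∀ s ∈ Icc (0 : ℝ) 1, X (h s) = Y (h s) := fun s hs => by
      refine hball ?_
      rw [← hgh s hs, IccExtend_of_mem _ _ hs]
      exact (ContinuousMap.dist_apply_le_dist (⟨s, hs⟩ : Icc (0 : ℝ) 1)).trans_lt hpc
    have hΦ' : ∀ s, HasDerivAt (fun s => Φ (p.1 * s) p.2) (p.1 • Y (Φ (p.1 * s) p.2)) s :=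
      fun s => (hΦ.hasDerivAt (p.1 * s) p.2 hp0).scomp s
        (by simpa using (hasDerivAt_id s).const_mul p.1)
    have huniq := ODE_solution_unique (v := fun _ x => p.1 • Y x) (K := ‖p.1‖₊ * L)
      (a := 0) (b := 1) (f := fun s => Φ (p.1 * s) p.2) (g := h)
      (fun _ => (lipschitzWith_smul p.1).comp hL)
      (fun s _ => (hΦ' s).continuousAt.continuousWithinAt)
      (fun s _ => (hΦ' s).hasDerivWithinAt)
      (fun s _ => (hh s).continuousAt.continuousWithinAt)
      (fun s hs => by
        have hs' : s ∈ Icc (0 : ℝ) 1 := ⟨hs.1, hs.2.le⟩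
        have := (hh s).hasDerivWithinAt (s := Ici s)
        rwa [hgh s hs', hXYs s hs'] at this)
      (by simp [h, hΦ.map_zero _ hp0])
    have h1 : (1 : ℝ) ∈ Icc (0 : ℝ) 1 := right_mem_Icc.2 zero_le_one
    have h2 : Φ (p.1 * 1) p.2 = h 1 := huniq h1
    rw [mul_one] at h2
    rw [h2, ← hgh 1 h1, IccExtend_of_mem _ _ h1]
    rfl
  exact (ev.contDiff.contDiffAt.comp (0, z₀) hg).congr_of_eventuallyEq hev

/-- Smoothness propagates along an orbit: the time `s₀` map is an iterate of short time maps, which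
are smooth near the compact orbit segment. -/
theorem contDiffOn (hΦ : IsFlowOffZero Y Φ) (hY : IsHomogeneousField Y) :
    ContDiffOn ℝ ∞ (fun p : ℝ × E => Φ p.1 p.2) (univ ×ˢ {0}ᶜ) := by
  rw [contDiffOn_infty]
  rintro k ⟨s₀, z₀⟩ ⟨-, hz₀⟩
  have hz₀ : z₀ ≠ 0 := hz₀
  refine ContDiffAt.contDiffWithinAt ?_
  have hcpt : IsCompact ((fun s => Φ s z₀) '' Icc (-|s₀|) |s₀|) :=
    isCompact_Icc.image_of_continuousOn
      fun s _ => (hΦ.hasDerivAt s z₀ hz₀).continuousAt.continuousWithinAt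
  have hev : ∀ᶠ δ in 𝓝 (0 : ℝ), ∀ y ∈ (fun s => Φ s z₀) '' Icc (-|s₀|) |s₀|,
      ContDiffAt ℝ k (fun p : ℝ × E => Φ p.1 p.2) (δ, y) := by
    refine hcpt.eventually_forall_of_forall_eventually ?_
    rintro _ ⟨s, -, rfl⟩
    exact ((hΦ.contDiffAt_zero hY (hΦ.ne_zero s z₀ hz₀)).of_le
      (by exact_mod_cast le_top)).eventually (by simp)
  obtain ⟨m, hm⟩ := ((tendsto_const_div_atTop_nhds_zero_nat s₀).comp
    (tendsto_add_atTop_nat 1)).eventually hev |>.exists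
  have hm0 : (0 : ℝ) < ((m + 1 : ℕ) : ℝ) := by positivity
  set δ : ℝ := s₀ / ((m + 1 : ℕ) : ℝ) with hδ
  have hind : ∀ j : ℕ, j ≤ m + 1 →
      ContDiffAt ℝ k (fun p : ℝ × E => Φ p.1 p.2) (j * δ, z₀) := by
    intro j
    induction j with
    | zero =>
      intro _
      simpa using (hΦ.contDiffAt_zero hY hz₀).of_le (by exact_mod_cast le_top)
    | succ j ih =>
      intro hj
      have hIH := ih (by omega)
      have hmem : (j : ℝ) * δ ∈ Icc (-|s₀|) |s₀| := by
        rw [mem_Icc, ← abs_le, hδ, abs_mul, abs_div, Nat.abs_cast, Nat.abs_cast, mul_div_assoc',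
          div_le_iff₀ hm0, mul_comm]
        gcongr
        omega
      have hout : ContDiffAt ℝ k (fun p : ℝ × E => Φ p.1 p.2) (δ, Φ (j * δ) z₀) :=
        hm _ ⟨_, hmem, rfl⟩
      have hin : ContDiffAt ℝ k (fun p : ℝ × E => (p.1 - j * δ, Φ (j * δ) p.2))
          (((j + 1 : ℕ) : ℝ) * δ, z₀) := by
        refine (contDiffAt_fst.sub contDiffAt_const).prodMk ?_
        exact ContDiffAt.comp (g := fun p : ℝ × E => Φ p.1 p.2)
          (f := fun p : ℝ × E => ((j : ℝ) * δ, p.2)) (((j + 1 : ℕ) : ℝ) * δ, z₀) hIH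
          (contDiffAt_const.prodMk contDiffAt_snd)
      have hpt : ((((j + 1 : ℕ) : ℝ) * δ) - j * δ, Φ (j * δ) z₀) = (δ, Φ (j * δ) z₀) := by
        congr 1
        push_cast
        ring
      have hcomp : ContDiffAt ℝ k (fun p : ℝ × E => Φ (p.1 - j * δ) (Φ (j * δ) p.2))
          (((j + 1 : ℕ) : ℝ) * δ, z₀) :=
        ContDiffAt.comp (g := fun p : ℝ × E => Φ p.1 p.2)
          (f := fun p : ℝ × E => (p.1 - j * δ, Φ (j * δ) p.2)) _ (by rw [hpt]; exact hout) hin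
      refine hcomp.congr_of_eventuallyEq ?_
      filter_upwards [continuousAt_snd.eventually_ne hz₀] with p hp
      rw [← hΦ.map_add hY _ _ hp, sub_add_cancel]
  have := hind (m + 1) le_rfl
  rwa [hδ, mul_div_cancel₀ _ hm0.ne'] at this

end IsFlowOffZero

/-! ### Hamiltonian fields of homogeneous functions -/

section Hamiltonian

variable {n : ℕ}

theorem IsHomogeneousTwo.map_zero {F : PhaseSpace n → ℝ} (hF : IsHomogeneousTwo F) : F 0 = 0 := by
  have := hF 2 two_pos 0
  rw [smul_zero] at this
  linarith

theorem IsHomogeneousTwo.fderiv_smul {F : PhaseSpace n → ℝ} (hF : IsHomogeneousTwo F)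
    (hs : ContDiffOn ℝ ∞ F {0}ᶜ) {c : ℝ} (hc : 0 < c) {z : PhaseSpace n} (hz : z ≠ 0) :
    fderiv ℝ F (c • z) = c • fderiv ℝ F z := by
  have h1 : (fun z => F (c • z)) = fun z => c ^ 2 • F z := funext fun z => hF c hc z
  have h2 := congrArg (fun f => fderiv ℝ f z) h1
  have hd : DifferentiableAt ℝ F z :=
    (hs.contDiffAt (isOpen_compl_singleton.mem_nhds hz)).differentiableAt (by simp)
  simp only [fderiv_comp_smul, fderiv_fun_const_smul hd] at h2
  rw [pow_two, mul_smul] at h2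
  exact smul_right_injective _ hc.ne' h2

/-- The linear map turning `dG` into the Hamiltonian vector `(∂G/∂p, -∂G/∂q)`. -/
noncomputable def symplecticGradient : (PhaseSpace n →L[ℝ] ℝ) →L[ℝ] PhaseSpace n :=
  ContinuousLinearMap.prod
    (ContinuousLinearMap.pi fun i =>
      ContinuousLinearMap.apply ℝ ℝ ((0, Pi.single i 1) : PhaseSpace n))
    (-ContinuousLinearMap.pi fun i =>
      ContinuousLinearMap.apply ℝ ℝ ((Pi.single i 1, 0) : PhaseSpace n))

theorem hamiltonianField_eq (G : PhaseSpace n → ℝ) (z : PhaseSpace n) :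
    hamiltonianField G z = symplecticGradient (fderiv ℝ G z) := rfl

theorem clm_apply_eq_sum (ℓ : PhaseSpace n →L[ℝ] ℝ) (v : PhaseSpace n) :
    ℓ v = ∑ i, (v.1 i * ℓ (Pi.single i 1, 0) + v.2 i * ℓ (0, Pi.single i 1)) := by
  have h1 : v = ∑ i, (v.1 i • ((Pi.single i 1, 0) : PhaseSpace n) +
      v.2 i • ((0, Pi.single i 1) : PhaseSpace n)) := by
    ext j <;>
      simp [Prod.fst_sum, Prod.snd_sum, Finset.sum_apply, Pi.single_apply]
  conv_lhs => rw [h1]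
  simp only [map_sum, map_add, map_smul, smul_eq_mul]

theorem fderiv_hamiltonianField (F G : PhaseSpace n → ℝ) (z : PhaseSpace n) :
    fderiv ℝ F z (hamiltonianField G z) = poissonBracket F G z := by
  rw [clm_apply_eq_sum, poissonBracket]
  refine Finset.sum_congr rfl fun i _ => ?_
  simp only [hamiltonianField, partialP, partialQ]
  ring

theorem poissonBracket_comm_neg (F G : PhaseSpace n → ℝ) (z : PhaseSpace n) :
    poissonBracket F G z = -poissonBracket G F z := by
  simp only [poissonBracket, ← Finset.sum_neg_distrib]
  exact Finset.sum_congr rfl fun i _ => by ring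

theorem symplecticForm_symplecticGradient (ℓ : PhaseSpace n →L[ℝ] ℝ) (w : PhaseSpace n) :
    symplecticForm (symplecticGradient ℓ) w = -ℓ w := by
  rw [clm_apply_eq_sum ℓ w, symplecticForm, ← Finset.sum_neg_distrib]
  refine Finset.sum_congr rfl fun i _ => ?_
  simp only [symplecticGradient, ContinuousLinearMap.prod_apply, _root_.neg_apply,
    ContinuousLinearMap.coe_pi', ContinuousLinearMap.apply_apply, Pi.neg_apply]
  ring

open Classical in
/-- The Hamiltonian field of `G`, with the value `0` at the origin, where `G` need not be
differentiable. -/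
noncomputable def homogeneousHamiltonianField (G : PhaseSpace n → ℝ) (z : PhaseSpace n) :
    PhaseSpace n :=
  if z = 0 then 0 else hamiltonianField G z

theorem homogeneousHamiltonianField_of_ne (G : PhaseSpace n → ℝ) {z : PhaseSpace n} (hz : z ≠ 0) :
    homogeneousHamiltonianField G z = hamiltonianField G z := if_neg hz

theorem IsHomogeneousTwo.isHomogeneousField {G : PhaseSpace n → ℝ} (hG : IsHomogeneousTwo G)
    (hs : ContDiffOn ℝ ∞ G {0}ᶜ) : IsHomogeneousField (homogeneousHamiltonianField G) where
  map_zero := if_pos rfl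
  map_smul c hc z := by
    rcases eq_or_ne z 0 with rfl | hz
    · simp [homogeneousHamiltonianField]
    · rw [homogeneousHamiltonianField_of_ne G hz,
        homogeneousHamiltonianField_of_ne G (smul_ne_zero hc.ne' hz), hamiltonianField_eq,
        hamiltonianField_eq, hG.fderiv_smul hs hc hz, _root_.map_smul]
  contDiffOn := by
    have h1 : ContDiffOn ℝ ∞ (fun z => symplecticGradient (fderiv ℝ G z)) {0}ᶜ :=
      symplecticGradient.contDiff.comp_contDiffOn
        (hs.fderiv_of_isOpen isOpen_compl_singleton (by simp))
    exact h1.congr fun z hz => by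
      rw [homogeneousHamiltonianField_of_ne G hz, hamiltonianField_eq]

end Hamiltonian

/-! ### Averaging over a periodic flow -/

section Averaging

variable {n : ℕ}

/-- The flow of a homogeneous periodic Hamiltonian, extended by zero to the origin. -/
theorem IsPeriodicHamiltonian.exists_flow {H : PhaseSpace n → ℝ} (hH : IsPeriodicHamiltonian H) :
    ∃ (T : ℝ) (Φ : ℝ → PhaseSpace n → PhaseSpace n), 0 < T ∧
      IsFlowOffZero (homogeneousHamiltonianField H) Φ ∧ (∀ s, Φ s 0 = 0) ∧
      ∀ z, z ≠ 0 → Function.Periodic (fun s => Φ s z) T := by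
  classical
  obtain ⟨T, hT, h⟩ := hH
  choose! γ h0 hne hd hper using h
  refine ⟨T, fun s z => if z = 0 then 0 else γ z s, hT, ⟨?_, ?_, ?_⟩, fun s => if_pos rfl, ?_⟩
  · intro z hz
    simp only [if_neg hz, h0 z hz]
  · intro s z hz
    simp only [if_neg hz]
    exact hne z hz s
  · intro s z hz
    simp only [if_neg hz]
    rw [homogeneousHamiltonianField_of_ne H (hne z hz s)]
    exact hd z hz s
  · intro z hz
    simp only [if_neg hz]
    exact hper z hz

/-- Translating a `T`-periodic `f` leaves `∫₀ᵀ f` unchanged, while `∫₀ᵀ r f(r) dr` has derivative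
`T f(0) - ∫₀ᵀ f` under translation, by integration by parts. -/
theorem hasDerivAt_periodic_average {f : ℝ → ℝ} {T : ℝ} (hf : Continuous f)
    (hper : Function.Periodic f T) :
    HasDerivAt (fun s => ∫ r in (0 : ℝ)..T, f (r + s)) 0 0 ∧
    HasDerivAt (fun s => ∫ r in (0 : ℝ)..T, r * f (r + s))
      (T * f 0 - ∫ r in (0 : ℝ)..T, f r) 0 := by
  have hconst : ∀ s, ∫ r in s..T + s, f r = ∫ r in (0 : ℝ)..T, f r := fun s => by
    have := hper.intervalIntegral_add_eq s 0
    rwa [zero_add, add_comm s T] at this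
  have h1 : (fun s => ∫ r in (0 : ℝ)..T, f (r + s)) = fun _ => ∫ r in (0 : ℝ)..T, f r := by
    funext s
    rw [intervalIntegral.integral_comp_add_right, zero_add, hconst]
  refine ⟨h1 ▸ hasDerivAt_const _ _, ?_⟩
  have hg : Continuous fun r => r * f r := continuous_id.mul hf
  have h2 : (fun s => ∫ r in (0 : ℝ)..T, r * f (r + s)) =
      fun s => ((∫ r in (0 : ℝ)..T + s, r * f r) - ∫ r in (0 : ℝ)..s, r * f r) -
        s * ∫ r in (0 : ℝ)..T, f r := by
    funext s
    have hs : Continuous fun r => s * f r := continuous_const.mul hf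
    rw [intervalIntegral.integral_interval_sub_left (hg.intervalIntegrable _ _)
      (hg.intervalIntegrable _ _), ← hconst s, ← intervalIntegral.integral_const_mul,
      ← intervalIntegral.integral_sub (hg.intervalIntegrable _ _)
        (hs.intervalIntegrable _ _)]
    have := intervalIntegral.integral_comp_add_right (a := 0) (b := T)
      (fun r => r * f r - s * f r) s
    rw [zero_add] at this
    rw [← this]
    refine intervalIntegral.integral_congr fun r _ => ?_
    ring
  rw [h2]
  have hp : ∀ x, HasDerivAt (fun u => ∫ r in (0 : ℝ)..u, r * f r) (x * f x) x := fun x =>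
    intervalIntegral.integral_hasDerivAt_right (hg.intervalIntegrable _ _)
      (hg.stronglyMeasurableAtFilter _ _) hg.continuousAt
  have h3 : HasDerivAt (fun s => ∫ r in (0 : ℝ)..T + s, r * f r) ((T + 0) * f (T + 0)) 0 :=
    (hp (T + 0)).comp_const_add T 0
  refine ((h3.sub (hp 0)).sub ((hasDerivAt_id (0 : ℝ)).mul_const _)).congr_deriv ?_
  have h4 : f T = f 0 := by simpa using hper 0
  simp [h4]

/-- **Averaging**: for a periodic homogeneous Hamiltonian `H` the equation `{H, G} + F = E` is
solvable with `E` commuting with `H`. With `Φ` the flow of `H`, of period `T`, the solution is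
`E = T⁻¹ ∫₀ᵀ F ∘ Φₛ ds` and `G = T⁻¹ ∫₀ᵀ s F ∘ Φₛ ds`. -/
theorem exists_average {H : PhaseSpace n → ℝ} (hH : IsHomogeneousTwo H)
    (hHs : ContDiffOn ℝ ∞ H {0}ᶜ) (hper : IsPeriodicHamiltonian H) {F : PhaseSpace n → ℝ}
    (hF : IsHomogeneousTwo F) (hFs : ContDiffOn ℝ ∞ F {0}ᶜ) :
    ∃ E G : PhaseSpace n → ℝ, ContDiffOn ℝ ∞ E {0}ᶜ ∧ IsHomogeneousTwo E ∧
      ContDiffOn ℝ ∞ G {0}ᶜ ∧ IsHomogeneousTwo G ∧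
      (∀ z, z ≠ 0 → poissonBracket E H z = 0) ∧
      ∀ z, z ≠ 0 → fderiv ℝ H z (hamiltonianField G z) + F z = E z := by
  obtain ⟨T, Φ, hT, hΦ, hΦ0, hΦT⟩ := hper.exists_flow
  have hY := hH.isHomogeneousField hHs
  have hΦs := hΦ.contDiffOn hY
  have hFΦ : ContDiffOn ℝ ∞ (fun q : PhaseSpace n × ℝ => F (Φ q.2 q.1)) ({0}ᶜ ×ˢ Icc 0 T) := by
    have h1 : ContDiffOn ℝ ∞ (fun q : PhaseSpace n × ℝ => Φ q.2 q.1) ({0}ᶜ ×ˢ Icc 0 T) :=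
      hΦs.comp (f := fun q : PhaseSpace n × ℝ => (q.2, q.1)) (ContDiff.contDiffOn (by fun_prop))
        (fun q hq => ⟨mem_univ _, hq.1⟩)
    exact hFs.comp (f := fun q : PhaseSpace n × ℝ => Φ q.2 q.1) h1
      (fun q hq => hΦ.ne_zero _ _ hq.1)
  have hopen : IsOpen ({0}ᶜ : Set (PhaseSpace n)) := isOpen_compl_singleton
  have hint := fun (w : ℝ → ℝ) (hw : ContDiff ℝ ∞ w) =>
    contDiffOn_intervalIntegral hopen.hasConvexNeighborhoods
      hopen.uniqueDiffOn hT (f := fun z s => w s * F (Φ s z))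
      ((hw.comp contDiff_snd).contDiffOn.mul hFΦ)
  have hhom : ∀ w : ℝ → ℝ,
      IsHomogeneousTwo fun z => T⁻¹ * ∫ s in (0 : ℝ)..T, w s * F (Φ s z) := by
    intro w c hc z
    have h1 : ∀ s, F (Φ s (c • z)) = c ^ 2 * F (Φ s z) := fun s => by
      rcases eq_or_ne z 0 with rfl | hz
      · simp [hΦ0, hF.map_zero]
      · rw [hΦ.map_smul hY s hc hz, hF c hc]
    simp only [h1, mul_left_comm _ (c ^ 2), intervalIntegral.integral_const_mul]
  have hEs : ContDiffOn ℝ ∞ (fun z => T⁻¹ * ∫ s in (0 : ℝ)..T, 1 * F (Φ s z)) {0}ᶜ :=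
    contDiffOn_const.mul (hint (fun _ => 1) contDiff_const)
  have hGs : ContDiffOn ℝ ∞ (fun z => T⁻¹ * ∫ s in (0 : ℝ)..T, s * F (Φ s z)) {0}ᶜ :=
    contDiffOn_const.mul (hint (fun s => s) contDiff_id)
  -- the bracket with `H` is the derivative along the flow
  have hbr : ∀ K : PhaseSpace n → ℝ, ContDiffOn ℝ ∞ K {0}ᶜ → ∀ z, z ≠ 0 →
      HasDerivAt (fun s => K (Φ s z)) (poissonBracket K H z) 0 := by
    intro K hK z hz
    have h1 : HasFDerivAt K (fderiv ℝ K (Φ 0 z)) (Φ 0 z) :=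
      ((hK.contDiffAt (isOpen_compl_singleton.mem_nhds (hΦ.ne_zero 0 z hz))).differentiableAt
        (by simp)).hasFDerivAt
    have h2 := h1.comp_hasDerivAt 0 (hΦ.hasDerivAt 0 z hz)
    rw [hΦ.map_zero z hz, homogeneousHamiltonianField_of_ne H hz, fderiv_hamiltonianField] at h2
    exact h2
  have hcont : ∀ z, z ≠ 0 → Continuous fun s => F (Φ s z) := fun z hz => by
    refine hFs.continuousOn.comp_continuous ?_ (fun s => hΦ.ne_zero s z hz)
    exact continuous_iff_continuousAt.2 fun s => (hΦ.hasDerivAt s z hz).continuousAt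
  have hav := fun z (hz : z ≠ 0) => hasDerivAt_periodic_average (hcont z hz)
    (fun s => congrArg F (hΦT z hz s))
  refine ⟨_, _, hEs, hhom _, hGs, hhom _, fun z hz => ?_, fun z hz => ?_⟩
  · refine (hbr _ hEs z hz).unique ?_
    have h1 := (hav z hz).1.const_mul T⁻¹
    rw [mul_zero] at h1
    refine h1.congr_of_eventuallyEq (Eventually.of_forall fun s => ?_)
    simp only [one_mul, hΦ.map_add hY _ _ hz]
  · rw [fderiv_hamiltonianField, poissonBracket_comm_neg]
    have h1 := (hav z hz).2.const_mul T⁻¹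
    have h2 := (hbr _ hGs z hz).unique (h1.congr_of_eventuallyEq (Eventually.of_forall fun s => by
      simp only [hΦ.map_add hY _ _ hz]))
    rw [h2, hΦ.map_zero z hz]
    simp only [one_mul]
    field_simp
    ring

end Averaging

/-! ### Midpoint generating functions -/

section Midpoint

variable {E : Type} [NormedAddCommGroup E] [NormedSpace ℝ E] {Y : E → E}

/-- An odd function of `x` with derivative `1/2` at `0` and, for `L > 0`, bounded by
`1 / (4 L)`. It replaces `x / 2` so that one construction serves all real values of the parameter. -/
noncomputable def cutoffHalf (L : ℝ) (x : ℝ) : ℝ := x / (2 * (1 + L ^ 2 * x ^ 2))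

theorem cutoffHalf_neg (L x : ℝ) : cutoffHalf L (-x) = -cutoffHalf L x := by
  simp [cutoffHalf, neg_div]

theorem cutoffHalf_zero (L : ℝ) : cutoffHalf L 0 = 0 := by simp [cutoffHalf]

theorem contDiff_cutoffHalf (L : ℝ) : ContDiff ℝ ∞ (cutoffHalf L) := by
  unfold cutoffHalf
  exact contDiff_id.div (by fun_prop) fun x => by positivity

theorem abs_cutoffHalf_mul_le (L x : ℝ) : |cutoffHalf L x| * L ≤ 1 / 2 := by
  rw [cutoffHalf, abs_div, abs_of_pos (show 0 < 2 * (1 + L ^ 2 * x ^ 2) by positivity),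
    div_mul_eq_mul_div, div_le_div_iff₀ (by positivity) two_pos]
  have h1 : (|x| * L) ^ 2 = L ^ 2 * x ^ 2 := by rw [mul_pow, sq_abs, mul_comm]
  nlinarith [sq_nonneg (|x| * L - 1)]

theorem hasDerivAt_cutoffHalf_zero (L : ℝ) : HasDerivAt (cutoffHalf L) (1 / 2) 0 := by
  have h1 : HasDerivAt (fun x : ℝ => 2 * (1 + L ^ 2 * x ^ 2)) (2 * (L ^ 2 * 0)) 0 := by
    have := (((hasDerivAt_pow 2 (0 : ℝ)).const_mul (L ^ 2)).const_add 1).const_mul 2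
    simpa using this
  exact ((hasDerivAt_id (0 : ℝ)).div h1 (by norm_num)).congr_deriv (by norm_num)

/-- The points `w = B x z` with `w - a(x) Y(w) = z` form a smooth family; the equation is solved by
contraction, and the smoothness comes from the implicit function theorem. -/
theorem IsHomogeneousField.exists_midpoint [FiniteDimensional ℝ E] (hY : IsHomogeneousField Y)
    {L : NNReal} (hL : LipschitzWith L Y) :
    ∃ B : ℝ → E → E, (∀ x z, B x z - cutoffHalf L x • Y (B x z) = z) ∧
      (∀ x z w, w - cutoffHalf L x • Y w = z → w = B x z) ∧
      ContDiffOn ℝ ∞ (fun q : ℝ × E => B q.1 q.2) (univ ×ˢ {0}ᶜ) ∧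
      ∀ x z, z ≠ 0 → B x z ≠ 0 := by
  have : CompleteSpace E := FiniteDimensional.complete ℝ E
  have hcontr : ∀ x z, ContractingWith (1 / 2) fun w => z + cutoffHalf L x • Y w := by
    intro x z
    refine ⟨by rw [← NNReal.coe_lt_coe]; norm_num, LipschitzWith.of_dist_le_mul fun v w => ?_⟩
    rw [dist_add_left, dist_smul₀, Real.norm_eq_abs]
    calc |cutoffHalf L x| * dist (Y v) (Y w) ≤ |cutoffHalf L x| * (L * dist v w) := by
          gcongr
          exact hL.dist_le_mul v w
      _ = (|cutoffHalf L x| * L) * dist v w := by ring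
      _ ≤ 1 / 2 * dist v w := by
          gcongr
          exact abs_cutoffHalf_mul_le L x
      _ = _ := by norm_num
  let B : ℝ → E → E := fun x z => (hcontr x z).fixedPoint
  have hB : ∀ x z, B x z - cutoffHalf L x • Y (B x z) = z := fun x z =>
    sub_eq_of_eq_add (hcontr x z).fixedPoint_isFixedPt.symm
  have huniq : ∀ x z w, w - cutoffHalf L x • Y w = z → w = B x z := fun x z w h =>
    (hcontr x z).fixedPoint_unique (x := w) (show z + _ = w by rw [← h, sub_add_cancel])
  have hne : ∀ x z, z ≠ 0 → B x z ≠ 0 := fun x z hz h => hz (by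
    have := hB x z
    rw [h, hY.map_zero, smul_zero, sub_zero] at this
    exact this.symm)
  refine ⟨B, hB, huniq, ?_, hne⟩
  rintro ⟨x₀, z₀⟩ ⟨-, hz₀⟩
  have hw₀ : B x₀ z₀ ≠ 0 := hne x₀ z₀ hz₀
  let P : (ℝ × E) × E → E := fun q => q.2 - cutoffHalf L q.1.1 • Y q.2 - q.1.2
  let u : (ℝ × E) × E := ((x₀, z₀), B x₀ z₀)
  have hP : ContDiffAt ℝ ∞ P u := by
    have h1 : ContDiffAt ℝ ∞ (fun q : (ℝ × E) × E => Y q.2) u :=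
      ContDiffAt.comp (g := Y) (f := fun q : (ℝ × E) × E => q.2) u (hY.contDiffAt hw₀)
        contDiffAt_snd
    have h2 : ContDiffAt ℝ ∞ (fun q : (ℝ × E) × E => cutoffHalf L q.1.1) u :=
      (contDiff_cutoffHalf L).contDiffAt.comp u contDiffAt_fst.fst
    exact (contDiffAt_snd.sub (h2.smul h1)).sub contDiffAt_fst.snd
  have hPu : P u = 0 := sub_eq_zero.2 (hB x₀ z₀)
  have hpart : fderiv ℝ P u ∘L .inr ℝ (ℝ × E) E = 1 - cutoffHalf L x₀ • fderiv ℝ Y (B x₀ z₀) := by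
    have h1 : HasFDerivAt (fun w : E => P (u.1, w)) (fderiv ℝ P u ∘L .inr ℝ (ℝ × E) E) u.2 :=
      (hP.differentiableAt (by simp)).hasFDerivAt.comp
        (f := fun w : E => (u.1, w)) u.2 (hasFDerivAt_prodMk_right u.1 u.2)
    have h2 : HasFDerivAt (fun w : E => w - cutoffHalf L x₀ • Y w - z₀)
        (.id ℝ E - cutoffHalf L x₀ • fderiv ℝ Y (B x₀ z₀)) (B x₀ z₀) :=
      ((hasFDerivAt_id _).fun_sub (((hY.contDiffAt hw₀).differentiableAt
        (by simp)).hasFDerivAt.fun_const_smul _)).sub_const _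
    exact h1.unique h2
  have hinv : (fderiv ℝ P u ∘L .inr ℝ (ℝ × E) E).IsInvertible := by
    rw [hpart]
    obtain ⟨v, hv⟩ := isUnit_one_sub_of_norm_lt_one
      (show ‖cutoffHalf L x₀ • fderiv ℝ Y (B x₀ z₀)‖ < 1 by
        rw [norm_smul, Real.norm_eq_abs]
        calc |cutoffHalf L x₀| * ‖fderiv ℝ Y (B x₀ z₀)‖ ≤ |cutoffHalf L x₀| * L := by
              gcongr
              exact norm_fderiv_le_of_lipschitz ℝ hL
          _ ≤ 1 / 2 := abs_cutoffHalf_mul_le L x₀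
          _ < 1 := by norm_num)
    rw [← hv]
    exact ContinuousLinearMap.isInvertible_equiv (f := ContinuousLinearEquiv.ofUnit v)
  refine ContDiffAt.contDiffWithinAt ((hP.contDiffAt_implicitFunction (by simp)
    hinv).congr_of_eventuallyEq ?_)
  filter_upwards [hP.eventually_apply_implicitFunction (by simp) hinv] with p hp
  rw [hPu] at hp
  exact (huniq p.1 p.2 _ (sub_eq_zero.1 hp)).symm

end Midpoint

section Cayley

variable {n : ℕ}

theorem symplecticForm_antisymm (v w : PhaseSpace n) :
    symplecticForm v w = -symplecticForm w v := by
  simp only [symplecticForm, ← Finset.sum_neg_distrib]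
  exact Finset.sum_congr rfl fun i _ => by ring

theorem symplecticForm_add_smul (a : ℝ) (u p u' p' : PhaseSpace n) :
    symplecticForm (u + a • p) (u' + a • p') = symplecticForm (u - a • p) (u' - a • p') +
      2 * a * (symplecticForm p u' + symplecticForm u p') := by
  simp only [symplecticForm, ← Finset.sum_add_distrib, Finset.mul_sum]
  refine Finset.sum_congr rfl fun i _ => ?_
  simp only [Prod.fst_add, Prod.snd_add, Prod.fst_sub, Prod.snd_sub, Prod.smul_fst, Prod.smul_snd,
    Pi.add_apply, Pi.sub_apply, Pi.smul_apply, smul_eq_mul]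
  ring

/-- The derivative of a Hamiltonian field is infinitesimally symplectic, by the symmetry of second
derivatives. -/
theorem symplecticForm_fderiv_hamiltonian {G : PhaseSpace n → ℝ} (hs : ContDiffOn ℝ ∞ G {0}ᶜ)
    {w : PhaseSpace n} (hw : w ≠ 0) (u u' : PhaseSpace n) :
    symplecticForm (fderiv ℝ (homogeneousHamiltonianField G) w u) u' +
      symplecticForm u (fderiv ℝ (homogeneousHamiltonianField G) w u') = 0 := by
  have hnhds := isOpen_compl_singleton.mem_nhds hw
  have h1 : homogeneousHamiltonianField G =ᶠ[𝓝 w]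
      fun z => symplecticGradient (fderiv ℝ G z) := by
    filter_upwards [hnhds] with z hz
    rw [homogeneousHamiltonianField_of_ne G hz, hamiltonianField_eq]
  have h2 : DifferentiableAt ℝ (fderiv ℝ G) w :=
    ((hs.fderiv_of_isOpen (m := ∞) isOpen_compl_singleton (by simp)).contDiffAt
      hnhds).differentiableAt (by simp)
  have h3 : HasFDerivAt (fun z => symplecticGradient (fderiv ℝ G z))
      (symplecticGradient ∘L fderiv ℝ (fderiv ℝ G) w) w :=
    (symplecticGradient (n := n)).hasFDerivAt.comp w h2.hasFDerivAt
  rw [h1.fderiv_eq, h3.fderiv, symplecticForm_antisymm u]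
  simp only [ContinuousLinearMap.comp_apply, symplecticForm_symplecticGradient]
  rw [((hs.contDiffAt hnhds).isSymmSndFDerivAt (by
    rw [minSmoothness_of_isRCLikeNormedField]
    exact WithTop.coe_le_coe.2 (le_top (a := (2 : ℕ∞))))).eq u u']
  ring

/-- The symplectic isotopy generated by a homogeneous `G`, in the form of the midpoint rule
`χ(z) - z = 2 a(x) X_G((z + χ(z)) / 2)`. It is symplectic because its derivative is the Cayley
transform `(1 + a DX_G) (1 - a DX_G)⁻¹` of an infinitesimally symplectic map, and its inverse is the
same map for `-x`. Unlike the flow of `X_G`, it is obtained without solving a differential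
equation. -/
theorem exists_isotopy_hasDerivAt {G : PhaseSpace n → ℝ} (hG : IsHomogeneousTwo G)
    (hs : ContDiffOn ℝ ∞ G {0}ᶜ) :
    ∃ χ : ℝ → PhaseSpace n → PhaseSpace n, IsHomogeneousSymplecticIsotopy univ χ ∧
      ∀ z, z ≠ 0 → HasDerivAt (fun x => χ x z) (hamiltonianField G z) 0 := by
  have hY := hG.isHomogeneousField hs
  set Y := homogeneousHamiltonianField G with hYdef
  obtain ⟨L, hL⟩ := hY.exists_lipschitzWith
  obtain ⟨B, hB, huniq, hBs, hBne⟩ := hY.exists_midpoint hL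
  let a := cutoffHalf L
  let χ : ℝ → PhaseSpace n → PhaseSpace n := fun x z => B x z + a x • Y (B x z)
  have hBχ : ∀ x z, B (-x) (χ x z) = B x z := fun x z => by
    refine (huniq _ _ _ ?_).symm
    rw [cutoffHalf_neg, neg_smul, sub_neg_eq_add]
  have hχχ : ∀ x z, χ (-x) (χ x z) = z := fun x z => by
    have : χ (-x) (χ x z) = B x z + a (-x) • Y (B x z) := by
      simp only [χ] at hBχ ⊢
      rw [hBχ]
    rw [this, show a (-x) = -a x from cutoffHalf_neg _ _, neg_smul, ← sub_eq_add_neg]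
    exact hB x z
  have hB0 : ∀ x, B x 0 = 0 := fun x =>
    (huniq x 0 0 (by rw [hY.map_zero, smul_zero, sub_zero])).symm
  have hχ0 : ∀ x, χ x 0 = 0 := fun x => by simp [χ, hB0, hY.map_zero]
  have hχne : ∀ x z, z ≠ 0 → χ x z ≠ 0 := fun x z hz h => hz (by
    rw [← hχχ x z, h, hχ0])
  have hYB : ContDiffOn ℝ ∞ (fun q : ℝ × PhaseSpace n => Y (B q.1 q.2)) (univ ×ˢ {0}ᶜ) :=
    hY.contDiffOn.comp hBs (fun q hq => hBne _ _ hq.2)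
  have hχs : ContDiffOn ℝ ∞ (fun q : ℝ × PhaseSpace n => χ q.1 q.2) (univ ×ˢ {0}ᶜ) :=
    hBs.add ((((contDiff_cutoffHalf L).comp contDiff_fst).contDiffOn).smul hYB)
  have hBz : ∀ z, B 0 z = z := fun z =>
    (huniq 0 z z (by rw [cutoffHalf_zero, zero_smul, sub_zero])).symm
  refine ⟨χ, ⟨hχs, fun x _ z hz => hχne x z hz, ⟨fun x => χ (-x), ?_, fun x _ =>
    ⟨fun z hz => hχne (-x) z hz, fun z _ => hχχ x z, fun z _ => ?_⟩⟩, ?_, ?_, ?_⟩, ?_⟩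
  · exact hχs.comp (f := fun q : ℝ × PhaseSpace n => (-q.1, q.2))
      (ContDiff.contDiffOn (by fun_prop)) (fun q hq => ⟨mem_univ _, hq.2⟩)
  · simpa using hχχ (-x) z
  · intro z _
    simp only [χ, hBz, show a 0 = 0 from cutoffHalf_zero _, zero_smul, add_zero]
  · intro x _ c hc z _
    have h1 : B x (c • z) = c • B x z := by
      refine (huniq _ _ _ ?_).symm
      rw [hY.map_smul c hc, smul_comm, ← smul_sub, hB]
    simp only [χ, h1, hY.map_smul c hc, smul_add]
    rw [smul_comm]
  · intro x _ z hz v v'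
    have hw : B x z ≠ 0 := hBne x z hz
    have hBd : HasFDerivAt (B x) (fderiv ℝ (B x) z) z := by
      have h1 : ContDiffAt ℝ ∞ (fun q : ℝ × PhaseSpace n => B q.1 q.2) (x, z) :=
        hBs.contDiffAt ((isOpen_univ.prod isOpen_compl_singleton).mem_nhds ⟨mem_univ _, hz⟩)
      have h2 : ContDiffAt ℝ ∞ (B x) z :=
        ContDiffAt.comp (g := fun q : ℝ × PhaseSpace n => B q.1 q.2)
          (f := fun z => (x, z)) z h1 (contDiffAt_const.prodMk contDiffAt_id)
      exact (h2.differentiableAt (by simp)).hasFDerivAt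
    have hYd : HasFDerivAt Y (fderiv ℝ Y (B x z)) (B x z) :=
      ((hY.contDiffAt hw).differentiableAt (by simp)).hasFDerivAt
    have hYBd : HasFDerivAt (fun z => a x • Y (B x z))
        (a x • fderiv ℝ Y (B x z) ∘L fderiv ℝ (B x) z) z :=
      (hYd.comp z hBd).fun_const_smul (a x)
    have hχd : ∀ v, fderiv ℝ (χ x) z v = fderiv ℝ (B x) z v +
        a x • fderiv ℝ Y (B x z) (fderiv ℝ (B x) z v) := fun v => by
      rw [show χ x = fun z => B x z + a x • Y (B x z) from rfl, (hBd.fun_add hYBd).fderiv]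
      rfl
    have hid : ∀ v, fderiv ℝ (B x) z v -
        a x • fderiv ℝ Y (B x z) (fderiv ℝ (B x) z v) = v := fun v => by
      have h1 : HasFDerivAt (fun z => B x z - a x • Y (B x z)) (.id ℝ _) z := by
        rw [show (fun z => B x z - a x • Y (B x z)) = id from funext (hB x)]
        exact hasFDerivAt_id z
      exact congrArg (fun ℓ => ℓ v) ((hBd.fun_sub hYBd).unique h1)
    rw [hχd, hχd, symplecticForm_add_smul, hid, hid, symplecticForm_fderiv_hamiltonian hs hw,
      mul_zero, add_zero]
  · intro z hz
    have h1 : (fun x => χ x z) = fun x => z + (2 * a x) • Y (B x z) := by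
      funext x
      have := hB x z
      rw [sub_eq_iff_eq_add] at this
      simp only [χ]
      nth_rewrite 1 [this]
      rw [two_mul, add_smul, add_assoc]
    have h2 : ContinuousAt (fun x => Y (B x z)) 0 := by
      have h3 : ContinuousAt (fun q : ℝ × PhaseSpace n => Y (B q.1 q.2)) (0, z) :=
        (hYB.contDiffAt ((isOpen_univ.prod isOpen_compl_singleton).mem_nhds
          (show ((0 : ℝ), z) ∈ univ ×ˢ {0}ᶜ from ⟨mem_univ _, hz⟩))).continuousAt
      exact ContinuousAt.comp (g := fun q : ℝ × PhaseSpace n => Y (B q.1 q.2))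
        (f := fun x => (x, z)) h3 (by fun_prop)
    have ha : HasDerivAt (fun x => 2 * a x) 1 0 := by
      simpa using (hasDerivAt_cutoffHalf_zero L).const_mul 2
    rw [h1, hasDerivAt_iff_tendsto_slope]
    have h4 := (hasDerivAt_iff_tendsto_slope.1 ha).smul (h2.tendsto.mono_left nhdsWithin_le_nhds)
    rw [one_smul, hBz, hYdef, homogeneousHamiltonianField_of_ne G hz] at h4
    refine h4.congr fun x => ?_
    simp only [slope, vsub_eq_sub, show a 0 = 0 from cutoffHalf_zero _, mul_zero, zero_smul,
      add_zero, add_sub_cancel_left, sub_zero, smul_eq_mul, smul_smul]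
    rw [hYdef]

end Cayley

/-! ### Isotopies: composition and Taylor expansion -/

section Isotopy

variable {n : ℕ}

theorem ContDiffOn.slice {E F : Type} [NormedAddCommGroup E] [NormedSpace ℝ E]
    [NormedAddCommGroup F] [NormedSpace ℝ F] {I : Set ℝ} {S : Set E} {f : ℝ × E → F}
    (hf : ContDiffOn ℝ ∞ f (I ×ˢ S)) {t : ℝ} (ht : t ∈ I) :
    ContDiffOn ℝ ∞ (fun z => f (t, z)) S :=
  hf.comp (f := fun z => (t, z)) (contDiffOn_const.prodMk contDiffOn_id) fun _ hz => ⟨ht, hz⟩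

theorem IsHomogeneousSymplecticIsotopy.differentiableAt {I : Set ℝ}
    {φ : ℝ → PhaseSpace n → PhaseSpace n} (hφ : IsHomogeneousSymplecticIsotopy I φ) {t : ℝ}
    (ht : t ∈ I) {z : PhaseSpace n} (hz : z ≠ 0) : DifferentiableAt ℝ (φ t) z :=
  ((hφ.smooth.slice ht).contDiffAt (isOpen_compl_singleton.mem_nhds hz)).differentiableAt (by simp)

theorem isHomogeneousSymplecticIsotopy_id (I : Set ℝ) :
    IsHomogeneousSymplecticIsotopy I fun _ (z : PhaseSpace n) => z where
  smooth := contDiffOn_snd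
  mapsTo _ _ := mapsTo_id _
  inverse := ⟨fun _ z => z, contDiffOn_snd, fun _ _ =>
    ⟨mapsTo_id _, fun _ _ => rfl, fun _ _ => rfl⟩⟩
  zero_eq_id _ _ := rfl
  homogeneous _ _ _ _ _ _ := rfl
  symplectic _ _ _ _ _ _ := by simp

theorem IsHomogeneousSymplecticIsotopy.comp_reparam {I : Set ℝ}
    {φ χ : ℝ → PhaseSpace n → PhaseSpace n} (hφ : IsHomogeneousSymplecticIsotopy I φ)
    (hχ : IsHomogeneousSymplecticIsotopy univ χ) {h : ℝ → ℝ} (hh : ContDiff ℝ ∞ h)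
    (h0 : h 0 = 0) : IsHomogeneousSymplecticIsotopy I fun t z => φ t (χ (h t) z) where
  smooth := by
    have h1 : ContDiffOn ℝ ∞ (fun q : ℝ × PhaseSpace n => χ (h q.1) q.2) (I ×ˢ {0}ᶜ) :=
      hχ.smooth.comp (f := fun q : ℝ × PhaseSpace n => (h q.1, q.2))
        ((hh.comp contDiff_fst).prodMk contDiff_snd).contDiffOn fun q hq => ⟨mem_univ _, hq.2⟩
    exact hφ.smooth.comp (f := fun q : ℝ × PhaseSpace n => (q.1, χ (h q.1) q.2))
      (contDiffOn_fst.prodMk h1) fun q hq => ⟨hq.1, hχ.mapsTo _ (mem_univ _) hq.2⟩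
  mapsTo t ht := (hφ.mapsTo t ht).comp (hχ.mapsTo _ (mem_univ _))
  inverse := by
    obtain ⟨ψ, hψs, hψ⟩ := hφ.inverse
    obtain ⟨η, hηs, hη⟩ := hχ.inverse
    refine ⟨fun t z => η (h t) (ψ t z), ?_, fun t ht => ⟨(hη _ (mem_univ _)).1.comp (hψ t ht).1,
      fun z hz => ?_, fun z hz => ?_⟩⟩
    · exact hηs.comp (f := fun q : ℝ × PhaseSpace n => (h q.1, ψ q.1 q.2))
        ((hh.comp contDiff_fst).contDiffOn.prodMk hψs)
        fun q hq => ⟨mem_univ _, (hψ _ hq.1).1 hq.2⟩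
    · simp only []
      rw [(hψ t ht).2.1 (hχ.mapsTo _ (mem_univ _) hz), (hη _ (mem_univ _)).2.1 hz]
    · simp only []
      rw [(hη _ (mem_univ _)).2.2 ((hψ t ht).1 hz), (hψ t ht).2.2 hz]
  zero_eq_id z hz := by rw [h0, hχ.zero_eq_id z hz, hφ.zero_eq_id z hz]
  homogeneous t ht c hc z hz := by
    rw [hχ.homogeneous _ (mem_univ _) c hc z hz,
      hφ.homogeneous t ht c hc _ (hχ.mapsTo _ (mem_univ _) hz)]
  symplectic t ht z hz v w := by
    have hχz : χ (h t) z ≠ 0 := hχ.mapsTo _ (mem_univ _) hz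
    have h1 : fderiv ℝ (fun z => φ t (χ (h t) z)) z =
        (fderiv ℝ (φ t) (χ (h t) z)).comp (fderiv ℝ (χ (h t)) z) :=
      fderiv_comp z (hφ.differentiableAt ht hχz) (hχ.differentiableAt (mem_univ _) hz)
    rw [h1, ContinuousLinearMap.comp_apply, ContinuousLinearMap.comp_apply,
      hφ.symplectic t ht _ hχz, hχ.symplectic _ (mem_univ _) z hz]

theorem contDiffOn_comp_isotopy {χ : ℝ → PhaseSpace n → PhaseSpace n}
    (hχ : IsHomogeneousSymplecticIsotopy univ χ) {h : PhaseSpace n → ℝ}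
    (hh : ContDiffOn ℝ ∞ h {0}ᶜ) :
    ContDiffOn ℝ ∞ (fun q : ℝ × PhaseSpace n => h (χ q.1 q.2)) (univ ×ˢ {0}ᶜ) :=
  hh.comp hχ.smooth fun _ hq => hχ.mapsTo _ (mem_univ _) hq.2

/-- First order Taylor expansion along an isotopy, with smooth remainder. -/
theorem exists_expansion_one {χ : ℝ → PhaseSpace n → PhaseSpace n}
    (hχ : IsHomogeneousSymplecticIsotopy univ χ) {h : PhaseSpace n → ℝ}
    (hh : ContDiffOn ℝ ∞ h {0}ᶜ) :
    ∃ b : ℝ × PhaseSpace n → ℝ, ContDiffOn ℝ ∞ b (univ ×ˢ {0}ᶜ) ∧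
      ∀ x z, z ≠ 0 → h (χ x z) = h z + x * b (x, z) := by
  obtain ⟨b, hb, hbe⟩ := exists_eq_add_mul_of_contDiffOn ordConnected_univ nontrivial_univ
    (mem_univ 0) isOpen_compl_singleton (contDiffOn_comp_isotopy hχ hh)
  refine ⟨b, hb, fun x z hz => ?_⟩
  have := hbe x (mem_univ _) z hz
  rwa [hχ.zero_eq_id z hz] at this

/-- Second order Taylor expansion along an isotopy with initial velocity `V`. -/
theorem exists_expansion_two {χ : ℝ → PhaseSpace n → PhaseSpace n}
    (hχ : IsHomogeneousSymplecticIsotopy univ χ) {V : PhaseSpace n → PhaseSpace n}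
    (hV : ∀ z, z ≠ 0 → HasDerivAt (fun x => χ x z) (V z) 0) {h : PhaseSpace n → ℝ}
    (hh : ContDiffOn ℝ ∞ h {0}ᶜ) :
    ∃ b : ℝ × PhaseSpace n → ℝ, ContDiffOn ℝ ∞ b (univ ×ˢ {0}ᶜ) ∧
      ∀ x z, z ≠ 0 → h (χ x z) = h z + x * fderiv ℝ h z (V z) + x ^ 2 * b (x, z) := by
  obtain ⟨b₁, hb₁, hbe₁⟩ := exists_expansion_one hχ hh
  obtain ⟨b₂, hb₂, hbe₂⟩ := exists_eq_add_mul_of_contDiffOn ordConnected_univ nontrivial_univ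
    (mem_univ 0) isOpen_compl_singleton hb₁
  refine ⟨b₂, hb₂, fun x z hz => ?_⟩
  -- the value of the first quotient at `x = 0` is the derivative of `h` along `V`
  have h1 : b₁ (0, z) = fderiv ℝ h z (V z) := by
    have hd : HasFDerivAt h (fderiv ℝ h (χ 0 z)) (χ 0 z) := by
      rw [hχ.zero_eq_id z hz]
      exact ((hh.contDiffAt (isOpen_compl_singleton.mem_nhds hz)).differentiableAt
        (by simp)).hasFDerivAt
    have hl := hd.comp_hasDerivAt 0 (hV z hz)
    rw [hχ.zero_eq_id z hz, hasDerivAt_iff_tendsto_slope] at hl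
    have hb₁c : ContinuousAt (fun x : ℝ => b₁ (x, z)) 0 :=
      ContinuousAt.comp (g := b₁) (f := fun x : ℝ => (x, z))
        (hb₁.contDiffAt ((isOpen_univ.prod isOpen_compl_singleton).mem_nhds
          (show ((0 : ℝ), z) ∈ univ ×ˢ {0}ᶜ from ⟨mem_univ _, hz⟩))).continuousAt (by fun_prop)
    refine tendsto_nhds_unique (hb₁c.tendsto.mono_left nhdsWithin_le_nhds) (hl.congr' ?_)
    filter_upwards [self_mem_nhdsWithin] with x hx
    have hx : x ≠ 0 := hx
    simp only [slope, Function.comp_apply, vsub_eq_sub, sub_zero, smul_eq_mul, hbe₁ _ z hz]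
    field_simp
    ring
  rw [hbe₁ x z hz, hbe₂ x (mem_univ _) z hz, h1]
  ring

end Isotopy

/-! ### The normal form -/

section NormalForm

variable {n : ℕ}

/-- The quotient of a homogeneous family by a power of `t` is homogeneous at `t = 0`, by
continuity. -/
theorem homogeneous_of_pow_mul {I : Set ℝ} (hI : I.OrdConnected) (hI' : I.Nontrivial)
    (h0 : (0 : ℝ) ∈ I) {R : ℝ × PhaseSpace n → ℝ} (hR : ContDiffOn ℝ ∞ R (I ×ˢ {0}ᶜ)) (k : ℕ)
    (hhom : ∀ t ∈ I, ∀ c : ℝ, 0 < c → ∀ z : PhaseSpace n, z ≠ 0 →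
      t ^ k * R (t, c • z) = c ^ 2 * (t ^ k * R (t, z)))
    {c : ℝ} (hc : 0 < c) {z : PhaseSpace n} (hz : z ≠ 0) :
    R (0, c • z) = c ^ 2 * R (0, z) := by
  have hcont : ∀ y : PhaseSpace n, y ≠ 0 → ContinuousOn (fun t : ℝ => R (t, y)) I := fun y hy =>
    hR.continuousOn.comp (f := fun t : ℝ => (t, y)) (by fun_prop) fun t ht => ⟨ht, hy⟩
  have hg : ContinuousOn (fun t : ℝ => R (t, c • z) - c ^ 2 * R (t, z)) I :=
    (hcont _ (smul_ne_zero hc.ne' hz)).sub (continuousOn_const.mul (hcont z hz))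
  have hacc : (𝓝[I \ {0}] (0 : ℝ)).NeBot := by
    have := uniqueDiffWithinAt_iff_accPt.1 (uniqueDiffOn_interval hI hI' 0 h0)
    exact accPt_principal_iff_nhdsWithin.1 this
  have h1 : Tendsto (fun t : ℝ => R (t, c • z) - c ^ 2 * R (t, z)) (𝓝[I \ {0}] 0)
      (𝓝 (R (0, c • z) - c ^ 2 * R (0, z))) :=
    (hg 0 h0).tendsto.mono_left (nhdsWithin_mono _ sdiff_subset)
  have h2 : Tendsto (fun t : ℝ => R (t, c • z) - c ^ 2 * R (t, z)) (𝓝[I \ {0}] 0) (𝓝 0) := by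
    refine tendsto_const_nhds.congr' ?_
    filter_upwards [self_mem_nhdsWithin] with t ht
    have h3 := hhom t ht.1 c hc z hz
    have ht0 : t ^ k ≠ 0 := pow_ne_zero k ht.2
    apply mul_left_cancel₀ ht0
    linear_combination -h3
  exact sub_eq_zero.1 (tendsto_nhds_unique h1 h2)

/-- The normal form, with the remainder in the form `t ^ (N + 1) R(t, z)` for a smooth `R`. -/
theorem exists_normalForm {I : Set ℝ} (hI : I.OrdConnected) (hI' : I.Nontrivial)
    (h0 : (0 : ℝ) ∈ I) {H : ℝ → PhaseSpace n → ℝ}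
    (hsmooth : ContDiffOn ℝ ∞ (fun x : ℝ × PhaseSpace n => H x.1 x.2) (I ×ˢ {0}ᶜ))
    (hhom : ∀ t ∈ I, IsHomogeneousTwo (H t)) (hper : IsPeriodicHamiltonian (H 0)) (N : ℕ) :
    ∃ (φ : ℝ → PhaseSpace n → PhaseSpace n) (E : ℕ → PhaseSpace n → ℝ)
      (R : ℝ × PhaseSpace n → ℝ), IsHomogeneousSymplecticIsotopy I φ ∧
      (∀ i ∈ Finset.Icc 1 N, ContDiffOn ℝ ∞ (E i) {0}ᶜ ∧ IsHomogeneousTwo (E i) ∧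
        ∀ z : PhaseSpace n, z ≠ 0 → poissonBracket (E i) (H 0) z = 0) ∧
      ContDiffOn ℝ ∞ R (I ×ˢ {0}ᶜ) ∧
      ∀ t ∈ I, ∀ z, z ≠ 0 → H t (φ t z) =
        H 0 z + ∑ i ∈ Finset.Icc 1 N, t ^ i * E i z + t ^ (N + 1) * R (t, z) := by
  induction N with
  | zero =>
    obtain ⟨R, hR, hRe⟩ := exists_eq_add_mul_of_contDiffOn hI hI' h0 isOpen_compl_singleton hsmooth
    refine ⟨fun _ z => z, fun _ _ => 0, R, isHomogeneousSymplecticIsotopy_id I, by simp, hR,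
      fun t ht z hz => ?_⟩
    simpa using hRe t ht z hz
  | succ N ih =>
    classical
    obtain ⟨φ, E, R, hφ, hE, hR, hexp⟩ := ih
    have hH0s : ContDiffOn ℝ ∞ (H 0) {0}ᶜ := hsmooth.slice h0
    have hH0h : IsHomogeneousTwo (H 0) := hhom 0 h0
    obtain ⟨R₁, hR₁, hRR₁⟩ := exists_eq_add_mul_of_contDiffOn hI hI' h0 isOpen_compl_singleton hR
    -- the value at the origin is prescribed, since `R` carries no information there
    let F : PhaseSpace n → ℝ := fun z => if z = 0 then 0 else R (0, z)
    have hFR : ∀ z, z ≠ 0 → F z = R (0, z) := fun z hz => if_neg hz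
    have hFs : ContDiffOn ℝ ∞ F {0}ᶜ := (hR.slice h0).congr fun z hz => hFR z hz
    have hFh : IsHomogeneousTwo F := by
      intro c hc z
      rcases eq_or_ne z 0 with rfl | hz
      · simp [F]
      · rw [hFR z hz, hFR _ (smul_ne_zero hc.ne' hz)]
        refine homogeneous_of_pow_mul hI hI' h0 hR (N + 1) (fun t ht c hc z hz => ?_) hc hz
        have h1 := hexp t ht z hz
        have h2 := hexp t ht (c • z) (smul_ne_zero hc.ne' hz)
        have h3 : ∑ i ∈ Finset.Icc 1 N, t ^ i * E i (c • z) =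
            c ^ 2 * ∑ i ∈ Finset.Icc 1 N, t ^ i * E i z := by
          rw [Finset.mul_sum]
          refine Finset.sum_congr rfl fun i hi => ?_
          rw [(hE i hi).2.1 c hc]
          ring
        rw [hφ.homogeneous t ht c hc z hz, hhom t ht c hc, hH0h c hc, h3] at h2
        linear_combination c ^ 2 * h1 - h2
    -- Composing with `χ` at time `t ^ (N + 1)` adds `{H 0, G}` to the coefficient `F` of
    -- `t ^ (N + 1)`, which turns it into the average `E'` and leaves the coefficients
    -- of lower order alone.
    obtain ⟨E', G, hE's, hE'h, hGs, hGh, hE'H, hGE'⟩ := exists_average hH0h hH0s hper hFh hFs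
    obtain ⟨χ, hχ, hχd⟩ := exists_isotopy_hasDerivAt hGh hGs
    obtain ⟨b₀, hb₀, hb₀e⟩ := exists_expansion_two hχ hχd hH0s
    obtain ⟨bF, hbF, hbFe⟩ := exists_expansion_one hχ hFs
    have hb : ∀ i, ∃ b : ℝ × PhaseSpace n → ℝ, i ∈ Finset.Icc 1 N →
        ContDiffOn ℝ ∞ b (univ ×ˢ {0}ᶜ) ∧
          ∀ x z, z ≠ 0 → E i (χ x z) = E i z + x * b (x, z) := fun i => by
      by_cases hi : i ∈ Finset.Icc 1 N
      · obtain ⟨b, hb⟩ := exists_expansion_one hχ (hE i hi).1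
        exact ⟨b, fun _ => hb⟩
      · exact ⟨fun _ => 0, fun h => absurd h hi⟩
    choose b hb using hb
    have hpow : ContDiff ℝ ∞ fun t : ℝ => t ^ (N + 1) := contDiff_id.pow _
    have hsub : ∀ {f : ℝ × PhaseSpace n → ℝ}, ContDiffOn ℝ ∞ f (univ ×ˢ {0}ᶜ) →
        ContDiffOn ℝ ∞ (fun q : ℝ × PhaseSpace n => f (q.1 ^ (N + 1), q.2)) (I ×ˢ {0}ᶜ) :=
      fun hf => hf.comp (f := fun q : ℝ × PhaseSpace n => (q.1 ^ (N + 1), q.2))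
        (ContDiff.contDiffOn (by fun_prop)) fun q hq => ⟨mem_univ _, hq.2⟩
    have hχI : ContDiffOn ℝ ∞ (fun q : ℝ × PhaseSpace n => χ (q.1 ^ (N + 1)) q.2) (I ×ˢ {0}ᶜ) :=
      hχ.smooth.comp (f := fun q : ℝ × PhaseSpace n => (q.1 ^ (N + 1), q.2))
        (ContDiff.contDiffOn (by fun_prop)) fun q hq => ⟨mem_univ _, hq.2⟩
    refine ⟨fun t z => φ t (χ (t ^ (N + 1)) z), fun i => if i = N + 1 then E' else E i,
      fun q => q.1 ^ N * b₀ (q.1 ^ (N + 1), q.2) +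
        ∑ i ∈ Finset.Icc 1 N, q.1 ^ (i - 1) * b i (q.1 ^ (N + 1), q.2) +
        q.1 ^ N * bF (q.1 ^ (N + 1), q.2) + R₁ (q.1, χ (q.1 ^ (N + 1)) q.2),
      hφ.comp_reparam hχ hpow (by simp), fun i hi => ?_, ?_, fun t ht z hz => ?_⟩
    · by_cases hiN : i = N + 1
      · simp only [hiN, if_true]
        exact ⟨hE's, hE'h, hE'H⟩
      · simp only [hiN, if_false]
        exact hE i (by rw [Finset.mem_Icc] at hi ⊢; omega)
    · have hfst : ∀ k : ℕ, ContDiffOn ℝ ∞ (fun q : ℝ × PhaseSpace n => q.1 ^ k) (I ×ˢ {0}ᶜ) :=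
        fun k => contDiffOn_fst.pow k
      refine ((((hfst N).mul (hsub hb₀)).add (ContDiffOn.sum fun i hi =>
        (hfst (i - 1)).mul (hsub (hb i hi).1))).add ((hfst N).mul (hsub hbF))).add ?_
      exact hR₁.comp (f := fun q : ℝ × PhaseSpace n => (q.1, χ (q.1 ^ (N + 1)) q.2))
        (contDiffOn_fst.prodMk hχI) fun q hq => ⟨hq.1, hχ.mapsTo _ (mem_univ _) hq.2⟩
    · have hy : χ (t ^ (N + 1)) z ≠ 0 := hχ.mapsTo _ (mem_univ _) hz
      have h1 : ∑ i ∈ Finset.Icc 1 N, t ^ i * E i (χ (t ^ (N + 1)) z) =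
          ∑ i ∈ Finset.Icc 1 N, t ^ i * E i z +
            t ^ (N + 2) * ∑ i ∈ Finset.Icc 1 N, t ^ (i - 1) * b i (t ^ (N + 1), z) := by
        rw [Finset.mul_sum, ← Finset.sum_add_distrib]
        refine Finset.sum_congr rfl fun i hi => ?_
        rw [(hb i hi).2 _ z hz]
        obtain ⟨j, rfl⟩ : ∃ j, i = j + 1 := ⟨i - 1, by rw [Finset.mem_Icc] at hi; omega⟩
        rw [Nat.add_sub_cancel]
        ring
      have h2 : ∑ i ∈ Finset.Icc 1 (N + 1), t ^ i * (if i = N + 1 then E' else E i) z =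
          ∑ i ∈ Finset.Icc 1 N, t ^ i * E i z + t ^ (N + 1) * E' z := by
        rw [Finset.sum_Icc_succ_top (by omega), if_pos rfl]
        congr 1
        refine Finset.sum_congr rfl fun i hi => ?_
        rw [if_neg (by rw [Finset.mem_Icc] at hi; omega)]
      simp only [h2]
      rw [hexp t ht _ hy, h1, hRR₁ t ht _ hy, ← hFR _ hy, hbFe _ z hz, hb₀e _ z hz, ← hGE' z hz]
      ring

/-! ### The remainder in the smooth topology -/

theorem contDiffOn_iteratedFDeriv_slice {E : Type} [NormedAddCommGroup E] [NormedSpace ℝ E]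
    {I : Set ℝ} (hI : UniqueDiffOn ℝ I) {S : Set E} (hS : IsOpen S) {f : ℝ × E → ℝ}
    (hf : ContDiffOn ℝ ∞ f (I ×ˢ S)) (m : ℕ) :
    ContDiffOn ℝ ∞ (fun q : ℝ × E => iteratedFDeriv ℝ m (fun z => f (q.1, z)) q.2) (I ×ˢ S) := by
  have hU : UniqueDiffOn ℝ (I ×ˢ S) := hI.prod hS.uniqueDiffOn
  induction m with
  | zero =>
    simp only [iteratedFDeriv_zero_eq_comp]
    exact (continuousMultilinearCurryFin0 ℝ E ℝ).symm.contDiff.comp_contDiffOn hf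
  | succ m ih =>
    simp only [iteratedFDeriv_succ_eq_comp_left]
    let e : (E →L[ℝ] E [×m]→L[ℝ] ℝ) ≃ₗᵢ[ℝ] (E [×(m + 1)]→L[ℝ] ℝ) :=
      (continuousMultilinearCurryLeftEquiv ℝ (fun _ : Fin (m + 1) => E) ℝ).symm
    have he : ContDiff ℝ ∞ e := LinearIsometryEquiv.contDiff (𝕜 := ℝ)
      (E := E →L[ℝ] E [×m]→L[ℝ] ℝ) (F := E [×(m + 1)]→L[ℝ] ℝ) e
    refine he.comp_contDiffOn ?_
    have h1 := ContDiffOn.clm_comp (ih.fderivWithin hU (m := ∞) (by simp))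
      (contDiffOn_const (c := ContinuousLinearMap.inr ℝ ℝ E))
    refine h1.congr fun q hq => ?_
    have h2 := ((ih.differentiableOn (by simp)) q hq).hasFDerivWithinAt
    have h3 : MapsTo (fun z : E => (q.1, z)) S (I ×ˢ S) := fun z hz => ⟨hq.1, hz⟩
    have h4 := h2.comp (f := fun z : E => (q.1, z)) q.2
      (hasFDerivAt_prodMk_right q.1 q.2).hasFDerivWithinAt h3
    exact (h4.hasFDerivAt (hS.mem_nhds hq.2)).fderiv

/-- A remainder `t ^ (N + 1) R(t, z)` with `R` smooth is `o(t ^ N)` in the smooth topology: the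
derivatives of `R` in `z` are jointly continuous, so they are bounded near `{0} × K`. -/
theorem isLittleOPowSmooth_of_contDiffOn {I : Set ℝ} (hI : I.OrdConnected) (hI' : I.Nontrivial)
    (h0 : (0 : ℝ) ∈ I) (N : ℕ) {R : ℝ × PhaseSpace n → ℝ} (hR : ContDiffOn ℝ ∞ R (I ×ˢ {0}ᶜ))
    {f : ℝ → PhaseSpace n → ℝ}
    (hf : ∀ t ∈ I, ∀ z, z ≠ 0 → f t z = t ^ (N + 1) * R (t, z)) :
    IsLittleOPowSmooth I N f := by
  intro m K hK hK0 ε hε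
  have hD := (contDiffOn_iteratedFDeriv_slice (uniqueDiffOn_interval hI hI')
    isOpen_compl_singleton hR m).continuousOn
  obtain ⟨M, hM⟩ := hK.exists_bound_of_continuousOn
    (f := fun z => iteratedFDeriv ℝ m (fun z => R (0, z)) z)
    (hD.comp (f := fun z => ((0 : ℝ), z)) (by fun_prop) fun z hz => ⟨h0, hK0 hz⟩)
  have hM' : ∀ᶠ t in 𝓝 (0 : ℝ), ∀ z ∈ K, t ∈ I → z ≠ 0 →
      ‖iteratedFDeriv ℝ m (fun z => R (t, z)) z‖ < |M| + 1 := by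
    refine hK.eventually_forall_of_forall_eventually fun z hz => ?_
    have h1 := (hD (0, z) ⟨h0, hK0 hz⟩).norm.eventually
      (gt_mem_nhds (show _ < |M| + 1 from ((hM z hz).trans (le_abs_self M)).trans_lt
        (lt_add_one _)))
    filter_upwards [eventually_nhdsWithin_iff.1 h1] with q hq hqI hq0
    exact hq ⟨hqI, hq0⟩
  have hsmall : ∀ᶠ t in 𝓝 (0 : ℝ), |t| * (|M| + 1) < ε := by
    have h1 : Continuous fun t : ℝ => |t| * (|M| + 1) := by fun_prop
    have h2 := h1.tendsto 0
    simp only [abs_zero, zero_mul] at h2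
    exact h2.eventually (gt_mem_nhds hε)
  filter_upwards [nhdsWithin_le_nhds hM', nhdsWithin_le_nhds hsmall, self_mem_nhdsWithin]
    with t htM htε htI z hz
  have hz0 : z ≠ 0 := hK0 hz
  have h1 : f t =ᶠ[𝓝 z] fun z => t ^ (N + 1) • R (t, z) := by
    filter_upwards [isOpen_compl_singleton.mem_nhds hz0] with y hy
    exact hf t htI y hy
  have h2 : ContDiffAt ℝ m (fun z => R (t, z)) z :=
    ((hR.slice htI).contDiffAt (isOpen_compl_singleton.mem_nhds hz0)).of_le
      (by exact_mod_cast le_top)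
  rw [(h1.iteratedFDeriv ℝ m).eq_of_nhds, iteratedFDeriv_const_smul_apply' h2, norm_smul,
    norm_pow, Real.norm_eq_abs]
  calc |t| ^ (N + 1) * ‖iteratedFDeriv ℝ m (fun z => R (t, z)) z‖
      ≤ |t| ^ (N + 1) * (|M| + 1) := by
        gcongr
        exact (htM z hz htI hz0).le
    _ = (|t| * (|M| + 1)) * |t| ^ N := by ring
    _ ≤ ε * |t| ^ N := by gcongr

end NormalForm

theorem proposition2 (n : ℕ) (I : Set ℝ) (hI : I.OrdConnected) (hI' : I.Nontrivial)
    (h0 : (0 : ℝ) ∈ I) (H : ℝ → PhaseSpace n → ℝ)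
    (hsmooth : ContDiffOn ℝ ∞ (fun x : ℝ × PhaseSpace n => H x.1 x.2) (I ×ˢ {0}ᶜ))
    (hhom : ∀ t ∈ I, IsHomogeneousTwo (H t))
    (hper : IsPeriodicHamiltonian (H 0)) (N : ℕ) :
    ∃ (φ : ℝ → PhaseSpace n → PhaseSpace n) (E : ℕ → PhaseSpace n → ℝ),
      IsHomogeneousSymplecticIsotopy I φ ∧
      (∀ i ∈ Finset.Icc 1 N,
        ContDiffOn ℝ ∞ (E i) {0}ᶜ ∧ IsHomogeneousTwo (E i) ∧
          ∀ z : PhaseSpace n, z ≠ 0 → poissonBracket (E i) (H 0) z = 0) ∧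
      IsLittleOPowSmooth I N
        (fun t z => H t (φ t z) - (H 0 z + ∑ i ∈ Finset.Icc 1 N, t ^ i * E i z)) := by
  obtain ⟨φ, E, R, hφ, hE, hR, hexp⟩ := exists_normalForm hI hI' h0 hsmooth hhom hper N
  refine ⟨φ, E, hφ, hE, isLittleOPowSmooth_of_contDiffOn hI hI' h0 N hR fun t ht z hz => ?_⟩
  rw [hexp t ht z hz, add_sub_cancel_left]
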